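/- Let $A$ be a self-adjoint operator in a complex Hilbert space $\mathcal H$ (with scalar product $(\cdot,\cdot)$ linear in the second argument) which is bounded from below, $A \ge c I$ for some $c\in\mathbb R$. Let $\sigma_d(A)$ be the set of isolated points of $\sigma(A)$ that are eigenvalues of finite multiplicity, $\sigma_{ess}(A)=\sigma(A)\setminus\sigma_d(A)$, and $\lambda_{0,ess}(A)=\inf\sigma_{ess}(A)$ (with $\inf\emptyset=+\infty$). Assume that $\lambda_{0,ess}(A)\in(c,\infty)\cup\{\infty\}$ and $\sigma_d(A)\cap[c,\lambda_{0,ess}(A))\neq\emptyset$. Let $\{\lambda_j(A)\}_{j\in J}$, where $J=\{1,\dots,N\}$ or $J=\mathbb N=\{1,2,\dots\}$, be the eigenvalues of $A$ below $\lambda_{0,ess}(A)$ in increasing order $\lambda_1(A)\le\lambda_2(A)\le\cdots$, repeated according to multiplicity. For $0\ne f\in\operatorname{dom}(|A|^{1/2})$ put $$R_A(f)=\frac{\big(|A|^{1/2}f,\operatorname{sgn}(A)|A|^{1/2}f\big)}{\|f\|^2}.$$ (i) (Operator version.) Suppose there are vectors $v_j\in\operatorname{dom}(A)\setminus\{0\}$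 and numbers $\mu_j(A)\in\mathbb R$, $j\in J$, such that, for every $j\in J$, $(v_j,v_k)=0$ for $1\le k\le j-1$ and $$\mu_j(A)=\frac{(v_j,Av_j)}{\|v_j\|^2}=\min_{\substack{0\ne f\in\operatorname{dom}(A)\\ (f,v_k)=0,\ 1\le k\le j-1}}\frac{(f,Af)}{\|f\|^2}.$$ Then, for every $j\in J$, $\mu_j(A)=\lambda_j(A)$ and $v_j$ is an eigenvector of $A$ with eigenvalue $\lambda_j(A)$. (ii) (Quadratic form version.) Suppose there are vectors $v_j\in\operatorname{dom}(|A|^{1/2})\setminus\{0\}$ and numbers $\mu_j(A)\in\mathbb R$, $j\in J$, such that, for every $j\in J$, $(v_j,v_k)=0$ for $1\le k\le j-1$ and $$\mu_j(A)=R_A(v_j)=\min_{\substack{0\ne f\in\operatorname{dom}(|A|^{1/2})\\ (f,v_k)=0,\ 1\le k\le j-1}}R_A(f).$$ Then, for every $j\in J$, $v_j\in\operatorname{dom}(A)$, $\mu_j(A)=\lambda_j(A)$, and $v_j$ is an eigenvector of $A$ with eigenvalue $\lambda_j(A)$. -/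

import Mathlib

open scoped InnerProductSpace

noncomputable section

namespace UnboundedOp

variable {H : Type*} [NormedAddCommGroup H] [InnerProductSpace ℂ H]

/-- The product `B A` on its natural domain `{x ∈ dom A | A x ∈ dom B}`. -/
def prod (B A : H →ₗ.[ℂ] H) : H →ₗ.[ℂ] H :=
  B.comp (A.domRestrict ((B.domain.comap A.toFun).map A.domain.subtype)) (by
    rintro ⟨x, ⟨y, hy, hyx⟩, hx⟩
    have h : y = ⟨x, hx⟩ := Subtype.ext hyx
    subst h
    exact hy)

/-- `z` is in the resolvent set of `A`: the operator `A - z` maps `dom A` bijectively onto `H`,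
with an everywhere defined bounded inverse `R`. -/
def resolventSet (A : H →ₗ.[ℂ] H) : Set ℂ :=
  {z | ∃ R : H →L[ℂ] H, (∀ x : A.domain, R (A x - z • (x : H)) = x) ∧
    ∀ y : H, ∃ h : R y ∈ A.domain, A ⟨R y, h⟩ - z • R y = y}

/-- The spectrum `σ(A)`. -/
def spectrum (A : H →ₗ.[ℂ] H) : Set ℂ := (resolventSet A)ᶜ

/-- `v` is an eigenvector of `A` with eigenvalue `z`; in particular `v ∈ dom A`. -/
def IsEigenvector (A : H →ₗ.[ℂ] H) (z : ℂ) (v : H) : Prop :=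
  v ≠ 0 ∧ ∃ h : v ∈ A.domain, A ⟨v, h⟩ = z • v

/-- The eigenspace `ker (A - z)`, a subspace of `H`. -/
def eigenspace (A : H →ₗ.[ℂ] H) (z : ℂ) : Submodule ℂ H :=
  (LinearMap.ker (A.toFun - z • A.domain.subtype)).map A.domain.subtype

/-- The discrete spectrum `σ_d(A)` of a self-adjoint operator: the isolated points of the spectrum
that are eigenvalues of finite multiplicity. -/
def discreteSpectrum (A : H →ₗ.[ℂ] H) : Set ℂ :=
  {z | z ∈ spectrum A ∧ (∃ ε > 0, ∀ w ∈ spectrum A, dist w z < ε → w = z) ∧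
    eigenspace A z ≠ ⊥ ∧ FiniteDimensional ℂ (eigenspace A z)}

/-- The essential spectrum `σ_ess(A) = σ(A) \ σ_d(A)` of a self-adjoint operator. -/
def essentialSpectrum (A : H →ₗ.[ℂ] H) : Set ℂ := spectrum A \ discreteSpectrum A

/-- `inf σ_ess(A)` in the extended reals (the spectrum of a self-adjoint operator is real); it is
`+∞` if the essential spectrum is empty. -/
def infEss (A : H →ₗ.[ℂ] H) : EReal :=
  sInf ((fun z : ℂ => (z.re : EReal)) '' essentialSpectrum A)

/-- The set `J = {1, 2, …}` that indexes the eigenvalues of `A` below `inf σ_ess(A)`: there are at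
least `j` of these, counted with multiplicity. (Eigenspaces of a self-adjoint operator are mutually
orthogonal, so the sum of their dimensions is the dimension of their span.) -/
def indexSet (A : H →ₗ.[ℂ] H) : Set ℕ :=
  {j | 1 ≤ j ∧ (j : Cardinal) ≤
    Module.rank ℂ (⨆ (t : ℝ) (_ : (t : EReal) < infEss A), eigenspace A (t : ℂ) :)}

/-- `λ_j(A)`, the `j`-th eigenvalue below `inf σ_ess(A)` in increasing order, counted with
multiplicity: the smallest eigenvalue `e` below `inf σ_ess(A)` such that at least `j` eigenvalues
(with multiplicity) are `≤ e`. It is meaningful for `j ∈ indexSet A`. -/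
def orderedEigenvalue (A : H →ₗ.[ℂ] H) (j : ℕ) : ℝ :=
  sInf {e : ℝ | (e : EReal) < infEss A ∧ eigenspace A (e : ℂ) ≠ ⊥ ∧
    (j : Cardinal) ≤ Module.rank ℂ (⨆ (t : ℝ) (_ : t ≤ e), eigenspace A (t : ℂ) :)}

/-- `A ≥ c I`. -/
def IsBoundedBelowBy (A : H →ₗ.[ℂ] H) (c : ℝ) : Prop :=
  ∀ x : A.domain, c * ‖(x : H)‖ ^ 2 ≤ (⟪(x : H), A x⟫_ℂ).re

/-- The Rayleigh quotient `(f, A f) / ‖f‖²` (a real number for self-adjoint `A`), `f ∈ dom A`. -/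
def rayleigh (A : H →ₗ.[ℂ] H) (f : A.domain) : ℝ :=
  (⟪(f : H), A f⟫_ℂ).re / ‖(f : H)‖ ^ 2

/-- The nonzero `f ∈ D` orthogonal to `v 1, …, v (j - 1)`. -/
def admissible {D : Submodule ℂ H} (v : ℕ → D) (j : ℕ) : Set D :=
  {f | f ≠ 0 ∧ ∀ k : ℕ, 1 ≤ k → k < j → ⟪(f : H), (v k : H)⟫_ℂ = 0}

/-- The vectors `v j ∈ D`, `j ∈ J`, successively minimize `R`, with minimum values `μ j`: each
`v j` is a minimizer of `R` over the nonzero vectors of `D` orthogonal to `v 1, …, v (j - 1)`. -/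
def SuccessivelyMinimizes {D : Submodule ℂ H} (R : D → ℝ) (J : Set ℕ) (v : ℕ → D) (μ : ℕ → ℝ) :
    Prop :=
  ∀ j ∈ J, v j ∈ admissible v j ∧ μ j = R (v j) ∧ IsLeast (R '' admissible v j) (μ j)

variable [CompleteSpace H]

/-- `S` is a nonnegative self-adjoint square root of `T`: `S = S* ≥ 0` and `S S = T`, domains
included. -/
def IsNonnegSqrt (S T : H →ₗ.[ℂ] H) : Prop :=
  IsSelfAdjoint S ∧ IsBoundedBelowBy S 0 ∧ prod S S = T

/-- `T^{1/2}` for a nonnegative self-adjoint operator `T`: its unique nonnegative self-adjoint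
square root. -/
def sqrt (T : H →ₗ.[ℂ] H) : H →ₗ.[ℂ] H := Classical.epsilon fun S => IsNonnegSqrt S T

/-- The absolute value `|A| = (A* A)^{1/2}`. -/
def abs (A : H →ₗ.[ℂ] H) : H →ₗ.[ℂ] H := sqrt (prod A.adjoint A)

/-- The operator `|A|^{1/2}`. -/
def absSqrt (A : H →ₗ.[ℂ] H) : H →ₗ.[ℂ] H := sqrt (abs A)

/-- `U` is the partial isometry in the polar decomposition of `A`: the bounded operator with
`A = U |A|` (domains included) that vanishes on `ker A`. As `H` is the closure of
`ran |A| ⊕ ker A`, there is only one. -/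
def IsPolarFactor (U : H →L[ℂ] H) (A : H →ₗ.[ℂ] H) : Prop :=
  (abs A).domain = A.domain ∧
  (∀ (x : H) (h : x ∈ (abs A).domain) (h' : x ∈ A.domain), U (abs A ⟨x, h⟩) = A ⟨x, h'⟩) ∧
  ∀ x : A.domain, A x = 0 → U x = 0

/-- `sgn(A)` for a self-adjoint operator `A` (with `sgn 0 = 0`): the partial isometry in the polar
decomposition `A = sgn(A) |A|`. -/
def sgn (A : H →ₗ.[ℂ] H) : H →L[ℂ] H := Classical.epsilon fun U => IsPolarFactor U A

/-- The quadratic-form Rayleigh quotient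
`R_A(f) = (|A|^{1/2} f, sgn(A) |A|^{1/2} f) / ‖f‖²`, `f ∈ dom |A|^{1/2}`. -/
def formRayleigh (A : H →ₗ.[ℂ] H) (f : (absSqrt A).domain) : ℝ :=
  (⟪absSqrt A f, sgn A (absSqrt A f)⟫_ℂ).re / ‖(f : H)‖ ^ 2

end UnboundedOp

end

/-! Both versions are one statement about a Hermitian form `a` on a subspace `D ⊇ dom A` with `a f g
= (f, A g)` for `g ∈ dom A`. Suppose `v 1, …, v (j - 1)` are already eigenvectors. The form `b = a -
μ j (·,·)` is nonnegative on the vectors of `D` orthogonal to them and `b (v j) (v j) = 0`, so a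
Cauchy–Schwarz argument gives `b f (v j) = 0` for all such `f`. Also `b (v k) (v j) = 0` for `k <
j`, because `v k` is an eigenvector orthogonal to `v j`. Hence `b g (v j) = 0` on all of `D`; for `g
∈ dom A` this reads `(A g, v j) = μ j (g, v j)`, and self-adjointness puts `v j` into `dom A` with
`A (v j) = μ j • v j` (`mem_graph_of_successivelyMinimizes`).

The values are found by counting. The `v 1, …, v j` are orthogonal eigenvectors with eigenvalues at
most `μ j`; conversely, a sum of eigenspaces of dimension at least `j` contains a nonzero vector
orthogonal to `v 1, …, v (j - 1)`, so one of its eigenvalues is at least `μ j`.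

Most of the work shows that the form built from `|A|^{1/2}` and `sgn A` agrees with `(f, A g)`
(`formOf_apply_of_mem_domain`). This needs square roots, a polar factor, and that the factor is
symmetric and commutes with `|A|^{1/2}`. In place of the spectral theorem, unbounded operators are
reduced to bounded ones such as `(1 + T)⁻¹`, to which `CFC.sqrt` applies. -/

noncomputable section

namespace UnboundedOp

variable {H : Type*} [NormedAddCommGroup H] [InnerProductSpace ℂ H]

/-! ### Operators as graphs, and self-adjointness in terms of graphs -/

section Graph

/-- The graph of a product of operators. -/
theorem mem_graph_prod {A B : H →ₗ.[ℂ] H} {x z : H} :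
    (x, z) ∈ (prod B A).graph ↔ ∃ y, (x, y) ∈ A.graph ∧ (y, z) ∈ B.graph := by
  constructor
  · intro h
    obtain ⟨w, hw, rfl⟩ := (LinearPMap.mem_graph_iff _).1 h
    obtain ⟨w, hwd⟩ := w
    obtain ⟨⟨u, hu, hux⟩, hw2⟩ := id hwd
    have hux' : u = ⟨w, hw2⟩ := Subtype.ext hux
    subst hux'
    simp only at hw
    subst hw
    refine ⟨A ⟨w, hw2⟩, LinearPMap.mem_graph A ⟨w, hw2⟩, ?_⟩
    exact LinearPMap.mem_graph B ⟨A ⟨w, hw2⟩, hu⟩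
  · rintro ⟨y, hxy, hyz⟩
    obtain ⟨u, hu, huy⟩ := (LinearPMap.mem_graph_iff _).1 hxy
    obtain ⟨w, hw, hwz⟩ := (LinearPMap.mem_graph_iff _).1 hyz
    simp only at hu huy hw hwz
    subst hu
    subst hwz
    have hAu : A u ∈ B.domain := by rw [huy, ← hw]; exact w.2
    have hmem : (u : H) ∈ (prod B A).domain := ⟨⟨u, hAu, rfl⟩, u.2⟩
    refine (LinearPMap.mem_graph_iff _).2 ⟨⟨u, hmem⟩, rfl, ?_⟩
    have : w = ⟨A u, hAu⟩ := Subtype.ext (hw.trans huy.symm)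
    rw [this]
    rfl

theorem graph_fun {A : H →ₗ.[ℂ] H} {x y y' : H} (h : (x, y) ∈ A.graph) (h' : (x, y') ∈ A.graph) :
    y = y' :=
  LinearPMap.mem_graph_snd_inj A h h' rfl

theorem apply_eq_of_mem_graph {A : H →ₗ.[ℂ] H} {x y : H} (h : (x, y) ∈ A.graph)
    (hx : x ∈ A.domain) : A ⟨x, hx⟩ = y :=
  graph_fun (LinearPMap.mem_graph A ⟨x, hx⟩) h

theorem linearPMap_ext_graph {A B : H →ₗ.[ℂ] H}
    (h : ∀ x y, (x, y) ∈ A.graph ↔ (x, y) ∈ B.graph) : A = B :=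
  LinearPMap.eq_of_eq_graph (by ext ⟨x, y⟩; exact h x y)

theorem isBoundedBelowBy_zero_iff {A : H →ₗ.[ℂ] H} :
    IsBoundedBelowBy A 0 ↔ ∀ x y, (x, y) ∈ A.graph → 0 ≤ (⟪x, y⟫_ℂ).re := by
  constructor
  · intro h x y hxy
    obtain ⟨u, hu, huy⟩ := (LinearPMap.mem_graph_iff _).1 hxy
    simp only at hu huy
    subst hu
    subst huy
    simpa using h u
  · intro h x
    simpa using h x (A x) (LinearPMap.mem_graph A x)

/-- `(1 + T)⁻¹ (x + T x) = x`. -/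
theorem inv_one_add_apply {T : H →ₗ.[ℂ] H} (h0 : IsBoundedBelowBy T 0) {B : H →L[ℂ] H}
    (hB : ∀ y, (B y, y - B y) ∈ T.graph) {x z : H} (h : (x, z) ∈ T.graph) : B (x + z) = x := by
  have h1 := T.graph.sub_mem h (hB (x + z))
  have h2 : ((x, z) - (B (x + z), x + z - B (x + z)) : H × H)
      = (x - B (x + z), -(x - B (x + z))) := by
    ext
    · rfl
    · simp only [Prod.snd_sub]; abel
  rw [h2] at h1
  have h3 := isBoundedBelowBy_zero_iff.1 h0 _ _ h1
  rw [inner_neg_right, inner_self_eq_norm_sq_to_K] at h3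
  have h4 : ‖x - B (x + z)‖ ^ 2 ≤ 0 := by
    have : (-((‖x - B (x + z)‖ : ℂ)) ^ 2).re = -(‖x - B (x + z)‖ ^ 2) := by norm_cast
    simp only [Complex.coe_algebraMap] at h3
    rw [this] at h3
    linarith
  have h5 : x - B (x + z) = 0 := by
    rw [← norm_eq_zero]
    nlinarith [norm_nonneg (x - B (x + z))]
  exact (sub_eq_zero.1 h5).symm

variable [CompleteSpace H]

theorem inner_graph_symm {A : H →ₗ.[ℂ] H} (hA : IsSelfAdjoint A) {x y x' y' : H}
    (h : (x, y) ∈ A.graph) (h' : (x', y') ∈ A.graph) : ⟪y, x'⟫_ℂ = ⟪x, y'⟫_ℂ := by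
  obtain ⟨u, rfl, rfl⟩ := (LinearPMap.mem_graph_iff _).1 h
  obtain ⟨w, rfl, rfl⟩ := (LinearPMap.mem_graph_iff _).1 h'
  have := LinearPMap.adjoint_isFormalAdjoint hA.dense_domain
  rw [LinearPMap.isSelfAdjoint_def.1 hA] at this
  exact this u w

/-- The hypothesis says that `(x, y)` lies in the graph of `A* = A`. It yields domain membership
throughout. -/
theorem mem_graph_of_forall_inner {A : H →ₗ.[ℂ] H} (hA : IsSelfAdjoint A) {x y : H}
    (h : ∀ x' y', (x', y') ∈ A.graph → ⟪x, y'⟫_ℂ = ⟪y, x'⟫_ℂ) : (x, y) ∈ A.graph := by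
  have h1 : ∀ u : A.domain, ⟪y, u⟫_ℂ = ⟪x, A u⟫_ℂ :=
    fun u => (h _ _ (LinearPMap.mem_graph A u)).symm
  have hx := LinearPMap.mem_adjoint_domain_of_exists x ⟨y, h1⟩
  have h2 : A.adjoint ⟨x, hx⟩ = y := LinearPMap.adjoint_apply_eq hA.dense_domain _ h1
  have h3 : (x, A.adjoint ⟨x, hx⟩) ∈ A.adjoint.graph := LinearPMap.mem_graph A.adjoint ⟨x, hx⟩
  rw [h2] at h3
  rwa [LinearPMap.isSelfAdjoint_def.1 hA] at h3

/-- The hypotheses `hs` and `hm` are `A ⊆ A*` and `A* ⊆ A`. -/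
theorem isSelfAdjoint_of_graph {A : H →ₗ.[ℂ] H} (hd : Dense (A.domain : Set H))
    (hs : ∀ x y x' y', (x, y) ∈ A.graph → (x', y') ∈ A.graph → ⟪y, x'⟫_ℂ = ⟪x, y'⟫_ℂ)
    (hm : ∀ x y, (∀ x' y', (x', y') ∈ A.graph → ⟪x, y'⟫_ℂ = ⟪y, x'⟫_ℂ) → (x, y) ∈ A.graph) :
    IsSelfAdjoint A := by
  rw [LinearPMap.isSelfAdjoint_def]
  refine linearPMap_ext_graph fun x y => ⟨fun h => ?_, fun h => ?_⟩
  · refine hm x y fun x' y' h' => ?_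
    obtain ⟨u, rfl, rfl⟩ := (LinearPMap.mem_graph_iff _).1 h
    obtain ⟨w, rfl, rfl⟩ := (LinearPMap.mem_graph_iff _).1 h'
    exact (LinearPMap.adjoint_isFormalAdjoint hd u w).symm
  · have h1 : ∀ u : A.domain, ⟪y, u⟫_ℂ = ⟪x, A u⟫_ℂ :=
      fun u => hs _ _ _ _ h (LinearPMap.mem_graph A u)
    have hx := LinearPMap.mem_adjoint_domain_of_exists x ⟨y, h1⟩
    have h2 : A.adjoint ⟨x, hx⟩ = y := LinearPMap.adjoint_apply_eq hd _ h1
    have h3 := LinearPMap.mem_graph A.adjoint ⟨x, hx⟩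
    rwa [h2] at h3

theorem isClosed_graph {A : H →ₗ.[ℂ] H} (hA : IsSelfAdjoint A) :
    IsClosed (A.graph : Set (H × H)) :=
  hA.isClosed

end Graph

/-! ### Bounded resolvents, squares and cores -/

section Resolvent

variable [CompleteSpace H]

/-- If `A - z` and `A - z̄` are bounded from below, then `A - z` has a bounded inverse. -/
theorem exists_resolvent {A : H →ₗ.[ℂ] H} (hA : IsSelfAdjoint A) (z : ℂ)
    (h : ∀ x y, (x, y) ∈ A.graph → ‖x‖ ≤ ‖y - z • x‖)
    (h' : ∀ x y, (x, y) ∈ A.graph → ‖x‖ ≤ ‖y - (starRingEnd ℂ z) • x‖) :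
    ∃ R : H →L[ℂ] H, (∀ y, (R y, y + z • R y) ∈ A.graph) ∧
      ∀ x y, (x, y) ∈ A.graph → R (y - z • x) = x := by
  have : CompleteSpace A.graph := (isClosed_graph hA).completeSpace_coe
  let f : A.graph →L[ℂ] H :=
    (ContinuousLinearMap.snd ℂ H H - z • ContinuousLinearMap.fst ℂ H H).comp A.graph.subtypeL
  have hf : ∀ p : A.graph, f p = p.1.2 - z • p.1.1 := fun p => rfl
  -- The graph carries the max norm, and `‖y‖ ≤ ‖y - z • x‖ + ‖z‖ ‖x‖`.
  have hbound : ∀ p : A.graph, ‖p‖ ≤ (1 + ‖z‖₊ : NNReal) * ‖f p‖ := by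
    rintro ⟨⟨x, y⟩, hxy⟩
    have h1 := h x y hxy
    have h0 : f ⟨(x, y), hxy⟩ = y - z • x := rfl
    rw [h0]
    have h2 : ‖y‖ ≤ ‖y - z • x‖ + ‖z‖ * ‖x‖ := by
      rw [← norm_smul]
      simpa using norm_add_le (y - z • x) (z • x)
    have h3 : 0 ≤ ‖z‖ := norm_nonneg z
    have h4 : ‖(⟨(x, y), hxy⟩ : A.graph)‖ = max ‖x‖ ‖y‖ := rfl
    rw [h4]
    push_cast
    apply max_le
    · nlinarith [norm_nonneg (y - z • x)]
    · nlinarith [norm_nonneg (y - z • x)]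
  have hanti := AddMonoidHomClass.antilipschitz_of_bound f hbound
  have hker : LinearMap.ker (f : A.graph →ₗ[ℂ] H) = ⊥ := LinearMap.ker_eq_bot.2 hanti.injective
  have hclosed : IsClosed (Set.range f) := hanti.isClosed_range f.uniformContinuous
  have hrange : LinearMap.range (f : A.graph →ₗ[ℂ] H) = ⊤ := by
    have hc : IsClosed ((LinearMap.range (f : A.graph →ₗ[ℂ] H) : Submodule ℂ H) : Set H) := by
      exact hclosed
    rw [← hc.submodule_topologicalClosure_eq, Submodule.topologicalClosure_eq_top_iff,
      Submodule.eq_bot_iff]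
    intro w hw
    rw [Submodule.mem_orthogonal'] at hw
    -- A vector orthogonal to the range is an eigenvector for `z̄`, which `h'` excludes unless it is
    -- zero.
    have hmem : (w, (starRingEnd ℂ z) • w) ∈ A.graph := by
      refine mem_graph_of_forall_inner hA fun x' y' hxy => ?_
      have := hw (f ⟨(x', y'), hxy⟩) ⟨_, rfl⟩
      rw [hf, inner_sub_right, inner_smul_right, sub_eq_zero] at this
      rw [this, inner_smul_left]
      simp
    have := h' _ _ hmem
    simpa using this
  let e := ContinuousLinearEquiv.ofBijective f hker hrange
  have he : ∀ p, e p = f p := fun p => rfl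
  refine ⟨(ContinuousLinearMap.fst ℂ H H).comp
    (A.graph.subtypeL.comp (e.symm : H →L[ℂ] A.graph)), fun y => ?_, fun x y hxy => ?_⟩
  · have h1 : f (e.symm y) = y := by rw [← he]; simp
    rw [hf, sub_eq_iff_eq_add] at h1
    have h2 := (e.symm y).2
    have h3 : ((e.symm y).1.1, y + z • (e.symm y).1.1) = (e.symm y).1 := Prod.ext rfl h1.symm
    change ((e.symm y).1.1, y + z • (e.symm y).1.1) ∈ A.graph
    rw [h3]
    exact h2
  · have h1 : e.symm (y - z • x) = ⟨(x, y), hxy⟩ := by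
      rw [ContinuousLinearEquiv.symm_apply_eq, he, hf]
    change (e.symm (y - z • x)).1.1 = x
    rw [h1]

/-- `1 + T` has a bounded inverse for nonnegative self-adjoint `T`. -/
theorem exists_inv_one_add {T : H →ₗ.[ℂ] H} (hT : IsSelfAdjoint T) (h0 : IsBoundedBelowBy T 0) :
    ∃ B : H →L[ℂ] H, ∀ y, (B y, y - B y) ∈ T.graph := by
  rw [isBoundedBelowBy_zero_iff] at h0
  have key : ∀ x y, (x, y) ∈ T.graph → ‖x‖ ≤ ‖y - (-1 : ℂ) • x‖ := by
    intro x y hxy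
    rcases (norm_nonneg x).eq_or_lt with h | h
    · rw [← h]; positivity
    have h1 := h0 x y hxy
    have h2 : (⟪x, y + x⟫_ℂ).re = (⟪x, y⟫_ℂ).re + ‖x‖ ^ 2 := by
      rw [inner_add_right, Complex.add_re, inner_self_eq_norm_sq_to_K]
      norm_cast
    have h3 : (⟪x, y + x⟫_ℂ).re ≤ ‖x‖ * ‖y + x‖ := re_inner_le_norm (𝕜 := ℂ) x (y + x)
    have h4 : y - (-1 : ℂ) • x = y + x := by simp
    rw [h4]
    nlinarith
  obtain ⟨R, hR, -⟩ := exists_resolvent hT (-1) key (by simpa using key)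
  refine ⟨R, fun y => ?_⟩
  simpa [sub_eq_add_neg] using hR y

/-- `A - z` is bounded from below for self-adjoint `A` and `z = ± i`. -/
theorem norm_le_norm_sub_I_smul {A : H →ₗ.[ℂ] H} (hA : IsSelfAdjoint A) {z : ℂ}
    (hz : z.re = 0) (hz1 : ‖z‖ = 1) {x y : H} (h : (x, y) ∈ A.graph) : ‖x‖ ≤ ‖y - z • x‖ := by
  have h1 := @norm_sub_sq ℂ H _ _ _ y (z • x)
  have h2 : (⟪x, y⟫_ℂ).im = 0 := by
    rw [← Complex.conj_eq_iff_im, inner_conj_symm]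
    exact inner_graph_symm hA h h
  have h3 : RCLike.re ⟪y, z • x⟫_ℂ = 0 := by
    rw [inner_smul_right, inner_graph_symm hA h h]
    simp [hz, h2]
  rw [h3, norm_smul, hz1] at h1
  have : ‖x‖ ^ 2 ≤ ‖y - z • x‖ ^ 2 := by rw [h1]; nlinarith [sq_nonneg ‖y‖]
  exact le_of_sq_le_sq this (norm_nonneg _)

theorem exists_resolvent_I {A : H →ₗ.[ℂ] H} (hA : IsSelfAdjoint A) :
    ∃ R : H →L[ℂ] H, (∀ y, (R y, y + Complex.I • R y) ∈ A.graph) ∧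
      ∀ x y, (x, y) ∈ A.graph → R (y - Complex.I • x) = x :=
  exists_resolvent hA _ (fun _ _ h => norm_le_norm_sub_I_smul hA (by simp) (by simp) h)
    (fun _ _ h => norm_le_norm_sub_I_smul hA (by simp) (by simp) h)

theorem exists_resolvent_neg_I {A : H →ₗ.[ℂ] H} (hA : IsSelfAdjoint A) :
    ∃ R : H →L[ℂ] H, (∀ y, (R y, y + (-Complex.I) • R y) ∈ A.graph) ∧
      ∀ x y, (x, y) ∈ A.graph → R (y - (-Complex.I) • x) = x :=
  exists_resolvent hA _ (fun _ _ h => norm_le_norm_sub_I_smul hA (by simp) (by simp) h)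
    (fun _ _ h => norm_le_norm_sub_I_smul hA (by simp) (by simp) h)

/-- For self-adjoint `S` there are bounded `B = (1 + S²)⁻¹` and `M = S B`. -/
theorem exists_inv_one_add_sq {S : H →ₗ.[ℂ] H} (hS : IsSelfAdjoint S) :
    ∃ B M : H →L[ℂ] H, ∀ y, (B y, M y) ∈ S.graph ∧ (M y, y - B y) ∈ S.graph := by
  obtain ⟨R, hR, -⟩ := exists_resolvent_I hS
  obtain ⟨R', hR', -⟩ := exists_resolvent_neg_I hS
  -- With `R = (S - i)⁻¹` and `R' = (S + i)⁻¹`: `B = R R'` and `S B = (S - i) R R' + i R R' = R' + i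
  -- R R'`.
  refine ⟨R.comp R', R' + Complex.I • R.comp R', fun y => ⟨hR (R' y), ?_⟩⟩
  have := S.graph.add_mem (hR' y) (S.graph.smul_mem Complex.I (hR (R' y)))
  convert this using 1
  ext
  · simp
  · simp only [ContinuousLinearMap.comp_apply, Prod.snd_add, Prod.smul_snd, smul_add, smul_smul,
      Complex.I_mul_I, neg_smul, one_smul]
    abel

theorem inner_sq_graph {S : H →ₗ.[ℂ] H} (hS : IsSelfAdjoint S) {x y z : H}
    (h : (x, y) ∈ S.graph) (h' : (y, z) ∈ S.graph) : ⟪x, z⟫_ℂ = (‖y‖ : ℂ) ^ 2 := by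
  rw [← inner_graph_symm hS h h', inner_self_eq_norm_sq_to_K]
  rfl

theorem isBoundedBelowBy_sq {S : H →ₗ.[ℂ] H} (hS : IsSelfAdjoint S) :
    IsBoundedBelowBy (prod S S) 0 := by
  rw [isBoundedBelowBy_zero_iff]
  intro x z h
  obtain ⟨y, h1, h2⟩ := mem_graph_prod.1 h
  rw [inner_sq_graph hS h1 h2]
  norm_cast
  positivity

/-- The square of a self-adjoint operator is self-adjoint. -/
theorem isSelfAdjoint_sq {S : H →ₗ.[ℂ] H} (hS : IsSelfAdjoint S) : IsSelfAdjoint (prod S S) := by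
  obtain ⟨B, M, hBM⟩ := exists_inv_one_add_sq hS
  have hB : ∀ y, (B y, y - B y) ∈ (prod S S).graph := fun y => mem_graph_prod.2 ⟨_, hBM y⟩
  have hsymm : ∀ x z x' z', (x, z) ∈ (prod S S).graph → (x', z') ∈ (prod S S).graph →
      ⟪z, x'⟫_ℂ = ⟪x, z'⟫_ℂ := by
    intro x z x' z' h h'
    obtain ⟨y, h1, h2⟩ := mem_graph_prod.1 h
    obtain ⟨y', h1', h2'⟩ := mem_graph_prod.1 h'
    rw [inner_graph_symm hS h2 h1', inner_graph_symm hS h1 h2']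
  refine isSelfAdjoint_of_graph ?_ hsymm ?_
  · rw [Submodule.dense_iff_topologicalClosure_eq_top, Submodule.topologicalClosure_eq_top_iff,
      Submodule.eq_bot_iff]
    intro w hw
    rw [Submodule.mem_orthogonal'] at hw
    have h1 : ⟪w, B w⟫_ℂ = 0 := hw _ (LinearPMap.mem_domain_of_mem_graph (hB w))
    have h2 : ⟪B w, w⟫_ℂ = (‖B w‖ : ℂ) ^ 2 + (‖M w‖ : ℂ) ^ 2 := by
      have := inner_sq_graph hS (hBM w).1 (hBM w).2
      rw [inner_sub_right, sub_eq_iff_eq_add, inner_self_eq_norm_sq_to_K] at this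
      rw [this, add_comm]
      rfl
    rw [inner_eq_zero_symm.1 h1] at h2
    have h3 : ‖B w‖ ^ 2 + ‖M w‖ ^ 2 = 0 := by exact_mod_cast h2.symm
    have h4 : B w = 0 := by
      rw [← norm_eq_zero]
      nlinarith [sq_nonneg ‖B w‖, sq_nonneg ‖M w‖]
    have h5 := hB w
    rw [h4, sub_zero] at h5
    exact LinearPMap.graph_fst_eq_zero_snd _ h5 rfl
  · intro x z h
    -- If `(x, z)` is in the graph of the adjoint of `S²`, symmetry forces `x = B (x + z)`, which is
    -- in `dom S²`.
    have h1 : x - B (x + z) = 0 := by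
      refine ext_inner_right ℂ fun y => ?_
      have e1 := h _ _ (hB y)
      have e2 := hsymm _ _ _ _ (hB (x + z)) (hB y)
      simp only [inner_sub_left, inner_sub_right, inner_add_left] at e1 e2 ⊢
      rw [inner_zero_left]
      linear_combination e1 + e2
    have h2 : B (x + z) = x := (sub_eq_zero.1 h1).symm
    have h3 := hB (x + z)
    rwa [h2, add_sub_cancel_left] at h3

/-- The domain of `S²` is a core of the self-adjoint operator `S`. -/
theorem mem_closure_core {S : H →ₗ.[ℂ] H} (hS : IsSelfAdjoint S) {p : H × H}
    (hp : p ∈ S.graph) : p ∈ closure {q : H × H | q ∈ S.graph ∧ ∃ z, (q.2, z) ∈ S.graph} := by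
  obtain ⟨B, M, hBM⟩ := exists_inv_one_add_sq hS
  -- The sup norm of `H × H` has no orthogonal complements, so the closure of `{(B y, M y)}` is
  -- studied in the Hilbert sum.
  let e : WithLp 2 (H × H) ≃L[ℂ] H × H := WithLp.prodContinuousLinearEquiv 2 ℂ H H
  let j : H →L[ℂ] WithLp 2 (H × H) := (e.symm : H × H →L[ℂ] WithLp 2 (H × H)).comp (B.prod M)
  let K : Submodule ℂ (WithLp 2 (H × H)) := (LinearMap.range (j : H →ₗ[ℂ] _)).topologicalClosure
  have : CompleteSpace K := (Submodule.isClosed_topologicalClosure _).completeSpace_coe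
  have hje : ∀ y, e (j y) = (B y, M y) := fun y => by simp [j]
  have hKc : ∀ q ∈ K, e q ∈ closure (Set.range fun y => (B y, M y)) := by
    intro q hq
    have h1 : q ∈ closure (Set.range j) := hq
    have h2 := image_closure_subset_closure_image e.continuous (Set.mem_image_of_mem e h1)
    rw [← Set.range_comp] at h2
    exact h2
  have hKg : ∀ q ∈ K, e q ∈ S.graph := by
    intro q hq
    refine closure_minimal ?_ (isClosed_graph hS) (hKc q hq)
    rintro _ ⟨y, rfl⟩
    exact (hBM y).1
  have hpK : e.symm p ∈ K := by
    obtain ⟨k, hk, q, hq, hkq⟩ := K.exists_add_mem_mem_orthogonal (e.symm p)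
    have hqg : e q ∈ S.graph := by
      have : e q = p - e k := by
        rw [eq_sub_iff_add_eq, ← map_add, add_comm q k, ← hkq]; simp
      rw [this]
      exact S.graph.sub_mem hp (hKg k hk)
    -- For `(u, S u)` orthogonal to every `(B y, M y)`: `0 = (u, B y) + (S u, M y) = (u, B y) + (u,
    -- y - B y) = (u, y)`.
    have hq0 : (e q).1 = 0 := by
      refine ext_inner_right ℂ fun y => ?_
      have h1 : ⟪q, j y⟫_ℂ = 0 := by
        rw [Submodule.mem_orthogonal'] at hq
        exact hq _ (Submodule.le_topologicalClosure _ ⟨y, rfl⟩)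
      have h2 : ⟪q, j y⟫_ℂ = ⟪(e q).1, B y⟫_ℂ + ⟪(e q).2, M y⟫_ℂ := by
        rw [WithLp.prod_inner_apply]; rfl
      have h3 : ⟪(e q).2, M y⟫_ℂ = ⟪(e q).1, y - B y⟫_ℂ := inner_graph_symm hS hqg (hBM y).2
      rw [h2, h3, inner_sub_right] at h1
      rw [inner_zero_left]
      linear_combination h1
    have hq1 : (e q).2 = 0 := LinearPMap.graph_fst_eq_zero_snd _ hqg hq0
    have : q = 0 := by
      apply e.injective
      rw [map_zero]
      exact Prod.ext hq0 hq1
    rw [hkq, this, add_zero]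
    exact hk
  have := hKc _ hpK
  rw [ContinuousLinearEquiv.apply_symm_apply] at this
  refine closure_mono ?_ this
  rintro _ ⟨y, rfl⟩
  exact ⟨(hBM y).1, _, (hBM y).2⟩

end Resolvent


/-! ### Square roots of nonnegative self-adjoint operators -/

section Sqrt

theorem re_inner_nonneg_of_nonneg {M : H →L[ℂ] H} (hM : 0 ≤ M) (x : H) :
    0 ≤ (⟪x, M x⟫_ℂ).re :=
  ((ContinuousLinearMap.nonneg_iff_isPositive M).1 hM).re_inner_nonneg_right x

variable [CompleteSpace H]

theorem nonneg_of_forall_inner {M : H →L[ℂ] H} (hs : ∀ x y, ⟪M x, y⟫_ℂ = ⟪x, M y⟫_ℂ)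
    (h0 : ∀ x, 0 ≤ (⟪x, M x⟫_ℂ).re) : 0 ≤ M := by
  rw [ContinuousLinearMap.nonneg_iff_isPositive]
  refine (ContinuousLinearMap.isPositive_iff' M).2 ⟨?_, fun x => ?_⟩
  · exact ContinuousLinearMap.isSelfAdjoint_iff_isSymmetric.2 hs
  · rw [hs x x, Complex.nonneg_iff]
    refine ⟨h0 x, ?_⟩
    rw [eq_comm, ← Complex.conj_eq_iff_im, inner_conj_symm, hs x x]

theorem inner_symm_of_nonneg {M : H →L[ℂ] H} (hM : 0 ≤ M) (x y : H) :
    ⟪M x, y⟫_ℂ = ⟪x, M y⟫_ℂ :=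
  ContinuousLinearMap.isSelfAdjoint_iff_isSymmetric.1 (IsSelfAdjoint.of_nonneg hM) x y

/-- A bounded operator commuting with a nonnegative bounded operator commutes with its square
root. -/
theorem commute_sqrt {b E : H →L[ℂ] H} (h : Commute b E) : Commute (CFC.sqrt b) E :=
  h.cfcₙ_nnreal _

/-- `(1 + T)⁻¹` is symmetric. -/
theorem inv_one_add_symm {T : H →ₗ.[ℂ] H} (hT : IsSelfAdjoint T) {B : H →L[ℂ] H}
    (hB : ∀ y, (B y, y - B y) ∈ T.graph) (x y : H) : ⟪B x, y⟫_ℂ = ⟪x, B y⟫_ℂ := by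
  have := inner_graph_symm hT (hB x) (hB y)
  simp only [inner_sub_left, inner_sub_right] at this
  linear_combination -this

theorem inv_one_add_nonneg {T : H →ₗ.[ℂ] H} (hT : IsSelfAdjoint T) (h0 : IsBoundedBelowBy T 0)
    {B : H →L[ℂ] H} (hB : ∀ y, (B y, y - B y) ∈ T.graph) : 0 ≤ B := by
  refine nonneg_of_forall_inner (inv_one_add_symm hT hB) fun x => ?_
  have := isBoundedBelowBy_zero_iff.1 h0 _ _ (hB x)
  rw [inner_sub_right, Complex.sub_re, inner_self_eq_norm_sq_to_K] at this
  have h2 : (((‖B x‖ : ℝ) : ℂ) ^ 2).re = ‖B x‖ ^ 2 := by norm_cast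
  rw [← inv_one_add_symm hT hB]
  simp only [Complex.coe_algebraMap] at this
  rw [h2] at this
  nlinarith [sq_nonneg ‖B x‖]

theorem one_sub_inv_one_add_nonneg {T : H →ₗ.[ℂ] H} (hT : IsSelfAdjoint T)
    (h0 : IsBoundedBelowBy T 0) {B : H →L[ℂ] H} (hB : ∀ y, (B y, y - B y) ∈ T.graph) :
    0 ≤ 1 - B := by
  have hs := inv_one_add_symm hT hB
  refine nonneg_of_forall_inner (fun x y => ?_) fun x => ?_
  · change ⟪x - B x, y⟫_ℂ = ⟪x, y - B y⟫_ℂ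
    rw [inner_sub_left, inner_sub_right, hs]
  · have h1 := isBoundedBelowBy_zero_iff.1 h0 _ _ (hB x)
    have h2 : ⟪x, (1 - B) x⟫_ℂ = ⟪B x, x - B x⟫_ℂ + ⟪x - B x, x - B x⟫_ℂ := by
      change ⟪x, x - B x⟫_ℂ = _
      rw [← inner_add_left, add_sub_cancel]
    rw [h2, inner_self_eq_norm_sq_to_K, Complex.add_re]
    have h3 : ((algebraMap ℝ ℂ ‖x - B x‖) ^ 2).re = ‖x - B x‖ ^ 2 := by
      simp only [Complex.coe_algebraMap]
      norm_cast
    rw [h3]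
    positivity

/-- Every nonnegative self-adjoint operator has a nonnegative self-adjoint square root. -/
theorem exists_isNonnegSqrt {T : H →ₗ.[ℂ] H} (hT : IsSelfAdjoint T) (h0 : IsBoundedBelowBy T 0) :
    ∃ S, IsNonnegSqrt S T := by
  obtain ⟨B, hB⟩ := exists_inv_one_add hT h0
  have hB0 := inv_one_add_nonneg hT h0 hB
  have hC0 := one_sub_inv_one_add_nonneg hT h0 hB
  set b := CFC.sqrt B with hb
  set C := CFC.sqrt (1 - B) with hC
  have hb0 : 0 ≤ b := CFC.sqrt_nonneg _
  have hCnn : 0 ≤ C := CFC.sqrt_nonneg _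
  have hbb : ∀ x, b (b x) = B x := fun x => by
    rw [← CFC.sqrt_mul_sqrt_self B hB0]; rfl
  have hCC : ∀ x, C (C x) = x - B x := fun x => by
    have := CFC.sqrt_mul_sqrt_self (1 - B) hC0
    change (C * C) x = (1 - B : H →L[ℂ] H) x
    rw [this]
  have hcomm : Commute b C := by
    have h1 : Commute B (1 - B) := (Commute.one_right B).sub_right (Commute.refl B)
    exact commute_sqrt (commute_sqrt h1.symm).symm
  have hbC : ∀ x, b (C x) = C (b x) := fun x => congrArg (fun f : H →L[ℂ] H => f x) hcomm.eq
  have hbs := inner_symm_of_nonneg hb0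
  have hCs := inner_symm_of_nonneg hCnn
  have hdecomp : ∀ x, x = b (b x) + C (C x) := fun x => by rw [hbb, hCC]; abel
  have hinj : ∀ x, b x = 0 → x = 0 := by
    intro x hx
    have h1 := hB x
    rw [← hbb, hx, map_zero, sub_zero] at h1
    exact LinearPMap.graph_fst_eq_zero_snd _ h1 rfl
  -- Since `T = (1 - B) B⁻¹`, its root should be `C b⁻¹`, with graph `{(b u, C u)}`.
  let S : H →ₗ.[ℂ] H := (LinearMap.range (b.prod C : H →ₗ[ℂ] H × H)).toLinearPMap
  have hS : ∀ x y, (x, y) ∈ S.graph ↔ ∃ u, b u = x ∧ C u = y := by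
    intro x y
    have : S.graph = LinearMap.range (b.prod C : H →ₗ[ℂ] H × H) := by
      refine Submodule.toLinearPMap_graph_eq _ ?_
      rintro _ ⟨u, rfl⟩ hu
      have : u = 0 := hinj u hu
      simp [this]
    rw [this]
    simp [LinearMap.mem_range, Prod.ext_iff]
  have hSA : IsSelfAdjoint S := by
    refine isSelfAdjoint_of_graph ?_ ?_ ?_
    · rw [Submodule.dense_iff_topologicalClosure_eq_top, Submodule.topologicalClosure_eq_top_iff,
        Submodule.eq_bot_iff]
      intro w hw
      rw [Submodule.mem_orthogonal'] at hw
      have h1 : ⟪w, b (b w)⟫_ℂ = 0 :=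
        hw _ (LinearPMap.mem_domain_of_mem_graph ((hS _ _).2 ⟨b w, rfl, rfl⟩))
      rw [← hbs] at h1
      exact hinj _ (inner_self_eq_zero.1 h1)
    · intro x y x' y' h h'
      obtain ⟨u, rfl, rfl⟩ := (hS _ _).1 h
      obtain ⟨u', rfl, rfl⟩ := (hS _ _).1 h'
      rw [← hbs, hbs, hbs, hCs, hbC]
    · intro x w h
      have h1 : b w = C x := by
        refine ext_inner_right ℂ fun y => ?_
        rw [hbs, hCs]
        exact (h _ _ ((hS _ _).2 ⟨y, rfl, rfl⟩)).symm
      -- If `x = b u` and `w = C u`, then `u = b (b u) + C (C u) = b x + C w`.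
      refine (hS _ _).2 ⟨b x + C w, ?_, ?_⟩
      · rw [map_add, hbC, h1]; exact (hdecomp x).symm
      · rw [map_add, ← hbC, ← h1]; exact (hdecomp w).symm
  refine ⟨S, hSA, ?_, ?_⟩
  · rw [isBoundedBelowBy_zero_iff]
    intro x y h
    obtain ⟨u, rfl, rfl⟩ := (hS _ _).1 h
    rw [hbs]
    exact re_inner_nonneg_of_nonneg (M := b * C) (hcomm.mul_nonneg hb0 hCnn) u
  · refine linearPMap_ext_graph fun x z => ⟨fun h => ?_, fun h => ?_⟩
    · obtain ⟨y, h1, h2⟩ := mem_graph_prod.1 h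
      obtain ⟨u, rfl, rfl⟩ := (hS _ _).1 h1
      obtain ⟨w, hw, rfl⟩ := (hS _ _).1 h2
      have h3 : u = b (b u + C w) := by
        rw [map_add, hbC, hw]; exact hdecomp u
      have h4 : C w = b u + C w - B (b u + C w) := by
        rw [← hbb, ← h3]; abel
      have h5 := hB (b u + C w)
      rwa [← h4, ← hbb, ← h3] at h5
    · have h1 : B (x + z) = x := inv_one_add_apply h0 hB h
      have h2 : z = C (C (x + z)) := by rw [hCC, h1]; abel
      refine mem_graph_prod.2 ⟨C (b (x + z)), (hS _ _).2 ⟨b (x + z), ?_, rfl⟩,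
        (hS _ _).2 ⟨C (x + z), hbC _, h2.symm⟩⟩
      rw [hbb, h1]

/-- A bounded operator that commutes with `S²` commutes with the nonnegative operator `S`. -/
theorem graph_commute_of_sq {S : H →ₗ.[ℂ] H} (hS : IsSelfAdjoint S) (h0 : IsBoundedBelowBy S 0)
    {E : H →L[ℂ] H} (hE : ∀ x z, (x, z) ∈ (prod S S).graph → (E x, E z) ∈ (prod S S).graph)
    {x y : H} (hxy : (x, y) ∈ S.graph) : (E x, E y) ∈ S.graph := by
  obtain ⟨B, M, hBM⟩ := exists_inv_one_add_sq hS
  have hB : ∀ y, (B y, y - B y) ∈ (prod S S).graph := fun y => mem_graph_prod.2 ⟨_, hBM y⟩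
  have hT0 := isBoundedBelowBy_sq hS
  have hinv : ∀ {x z}, (x, z) ∈ (prod S S).graph → B (x + z) = x := inv_one_add_apply hT0 hB
  have hBE : Commute B E := by
    ext y
    have := hinv (hE _ _ (hB y))
    rw [← map_add, add_sub_cancel] at this
    exact this
  have hMs : ∀ y y', ⟪M y, y'⟫_ℂ = ⟪y, M y'⟫_ℂ := by
    intro y y'
    have h1 := inner_graph_symm hS (hBM y).1 (hBM y').1
    have h2 := inner_graph_symm hS (hBM y).2 (hBM y').2
    simp only [inner_sub_left, inner_sub_right] at h2
    linear_combination h1 - h2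
  have hM0 : 0 ≤ M := by
    refine nonneg_of_forall_inner hMs fun y => ?_
    have h1 := isBoundedBelowBy_zero_iff.1 h0 _ _ (hBM y).1
    have h2 := isBoundedBelowBy_zero_iff.1 h0 _ _ (hBM y).2
    have h3 : ⟪M y, B y⟫_ℂ = ⟪B y, M y⟫_ℂ := inner_graph_symm hS (hBM y).1 (hBM y).1
    rw [inner_sub_right, Complex.sub_re, h3] at h2
    rw [← hMs]
    linarith
  have hBS : ∀ {x y}, (x, y) ∈ S.graph → B y = M x := by
    intro x y h
    have h1 := S.graph.sub_mem h (hBM x).1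
    have h2 := hinv (mem_graph_prod.2 ⟨_, (hBM x).2, h1⟩)
    simpa using h2
  -- `M = S B` is the nonnegative root of `B - B²`, so whatever commutes with `B` commutes with `M`.
  have hMM : M * M = B - B * B := by
    ext y
    have h1 := hBS (hBM y).2
    change M (M y) = B y - B (B y)
    rw [← h1, map_sub]
  have hME : Commute M E := by
    have h1 : Commute (B - B * B) E := hBE.sub_left (hBE.mul_left hBE)
    have h2 := commute_sqrt h1
    rwa [CFC.sqrt_unique hMM hM0] at h2
  have hclosed : IsClosed {p : H × H | (E p.1, E p.2) ∈ S.graph} :=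
    (isClosed_graph hS).preimage (by fun_prop : Continuous fun p : H × H => (E p.1, E p.2))
  -- On the core `dom S²` one has `x = B (x + z)` and `S x = M (x + z)` with `z = S² x`; closedness
  -- of the graph does the rest.
  refine closure_minimal ?_ hclosed (mem_closure_core hS hxy)
  rintro ⟨x, y⟩ ⟨h1, z, h2⟩
  have h3 : B (x + z) = x := hinv (mem_graph_prod.2 ⟨_, h1, h2⟩)
  have h4 := hBM (x + z)
  rw [h3] at h4
  have h5 : M (x + z) = y := graph_fun h4.1 h1
  have h6 : E (B (x + z)) = B (E (x + z)) :=
    congrArg (fun f : H →L[ℂ] H => f (x + z)) hBE.symm.eq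
  have h7 : E (M (x + z)) = M (E (x + z)) :=
    congrArg (fun f : H →L[ℂ] H => f (x + z)) hME.symm.eq
  rw [h3] at h6
  rw [h5] at h7
  change (E x, E y) ∈ S.graph
  rw [h6, h7]
  exact (hBM _).1

end Sqrt


/-! ### Polar decomposition, `sgn A` and the form of `A` -/

section Polar

variable [CompleteSpace H]

/-- A vector orthogonal to `ran P` is in `ker P* = ker P`, hence orthogonal to itself. -/
theorem eq_zero_of_inner_range_ker {P : H →ₗ.[ℂ] H} (hP : IsSelfAdjoint P) {v : H}
    (h1 : ∀ x p, (x, p) ∈ P.graph → ⟪v, p⟫_ℂ = 0) (h2 : ∀ k, (k, 0) ∈ P.graph → ⟪v, k⟫_ℂ = 0) :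
    v = 0 := by
  have : (v, (0 : H)) ∈ P.graph := by
    refine mem_graph_of_forall_inner hP fun x p h => ?_
    rw [h1 x p h, inner_zero_left]
  exact inner_self_eq_zero.1 (h2 v this)

/-- Bounded operators that agree on `ran P` and on `ker P` are equal. -/
theorem ext_range_ker {P : H →ₗ.[ℂ] H} (hP : IsSelfAdjoint P) {F G : H →L[ℂ] H}
    (h1 : ∀ x p, (x, p) ∈ P.graph → F p = G p) (h2 : ∀ k, (k, 0) ∈ P.graph → F k = G k) :
    F = G := by
  rw [← sub_eq_zero]
  ext w
  refine ext_inner_left ℂ fun u => ?_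
  have h : (F - G).adjoint u = 0 := by
    refine eq_zero_of_inner_range_ker hP (fun x p h => ?_) fun k h => ?_
    · rw [ContinuousLinearMap.adjoint_inner_left]
      simp [h1 x p h]
    · rw [ContinuousLinearMap.adjoint_inner_left]
      simp [h2 k h]
  rw [← ContinuousLinearMap.adjoint_inner_left, h]
  simp

/-- Self-adjoint operators with the same square have the same domain and the same norms. -/
theorem exists_mem_graph_of_sq_eq {A P : H →ₗ.[ℂ] H} (hA : IsSelfAdjoint A) (hP : IsSelfAdjoint P)
    (h : prod P P = prod A A) {x y : H} (hxy : (x, y) ∈ A.graph) :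
    ∃ p, (x, p) ∈ P.graph ∧ ‖p‖ = ‖y‖ := by
  have hcore : ∀ q : H × H, q ∈ A.graph → (∃ z, (q.2, z) ∈ A.graph) →
      ∃ p, (q.1, p) ∈ P.graph ∧ ‖p‖ = ‖q.2‖ := by
    rintro ⟨x, y⟩ h1 ⟨z, h2⟩
    have h3 : (x, z) ∈ (prod P P).graph := by rw [h]; exact mem_graph_prod.2 ⟨y, h1, h2⟩
    obtain ⟨p, h4, h5⟩ := mem_graph_prod.1 h3
    refine ⟨p, h4, ?_⟩
    have h6 := (inner_sq_graph hP h4 h5).symm.trans (inner_sq_graph hA h1 h2)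
    have h7 : ‖p‖ ^ 2 = ‖y‖ ^ 2 := by exact_mod_cast h6
    exact (pow_left_inj₀ (norm_nonneg _) (norm_nonneg _) two_ne_zero).1 h7
  -- On the core, `‖P x‖² = (x, P² x) = (x, A² x) = ‖A x‖²`. So along a sequence of core elements
  -- the `P x` are Cauchy with the `A x`.
  obtain ⟨q, hq, hlim⟩ := mem_closure_iff_seq_limit.1 (mem_closure_core hA hxy)
  choose p hp hpn using fun n => hcore (q n) (hq n).1 (hq n).2
  have hdist : ∀ n m, dist (p n) (p m) = dist (q n).2 (q m).2 := by
    intro n m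
    obtain ⟨z, hz⟩ := (hq n).2
    obtain ⟨z', hz'⟩ := (hq m).2
    obtain ⟨r, hr, hrn⟩ := hcore (q n - q m) (A.graph.sub_mem (hq n).1 (hq m).1)
      ⟨z - z', A.graph.sub_mem hz hz'⟩
    have : r = p n - p m := graph_fun hr (P.graph.sub_mem (hp n) (hp m))
    rw [dist_eq_norm, dist_eq_norm, ← this, hrn]
    rfl
  have hl1 : Filter.Tendsto (fun n => (q n).1) Filter.atTop (nhds x) :=
    (continuous_fst.tendsto _).comp hlim
  have hl2 : Filter.Tendsto (fun n => (q n).2) Filter.atTop (nhds y) :=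
    (continuous_snd.tendsto _).comp hlim
  have hc : CauchySeq p := by
    have := hl2.cauchySeq
    rw [Metric.cauchySeq_iff] at this ⊢
    simpa only [hdist] using this
  obtain ⟨p0, hp0⟩ := cauchySeq_tendsto_of_complete hc
  refine ⟨p0, ?_, ?_⟩
  · exact (isClosed_graph hP).mem_of_tendsto (hl1.prodMk_nhds hp0)
      (Filter.Eventually.of_forall hp)
  · refine tendsto_nhds_unique hp0.norm ?_
    simpa only [hpn] using hl2.norm

theorem domain_eq_of_sq_eq {A P : H →ₗ.[ℂ] H} (hA : IsSelfAdjoint A) (hP : IsSelfAdjoint P)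
    (h : prod P P = prod A A) : P.domain = A.domain := by
  ext x
  constructor
  · intro hx
    obtain ⟨y, hy⟩ := LinearPMap.mem_domain_iff.1 hx
    obtain ⟨p, hp, -⟩ := exists_mem_graph_of_sq_eq hP hA h.symm hy
    exact LinearPMap.mem_domain_of_mem_graph hp
  · intro hx
    obtain ⟨y, hy⟩ := LinearPMap.mem_domain_iff.1 hx
    obtain ⟨p, hp, -⟩ := exists_mem_graph_of_sq_eq hA hP h hy
    exact LinearPMap.mem_domain_of_mem_graph hp

theorem norm_eq_of_sq_eq {A P : H →ₗ.[ℂ] H} (hA : IsSelfAdjoint A) (hP : IsSelfAdjoint P)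
    (h : prod P P = prod A A) {x y p : H} (hxy : (x, y) ∈ A.graph) (hxp : (x, p) ∈ P.graph) :
    ‖p‖ = ‖y‖ := by
  obtain ⟨p', hp', hn⟩ := exists_mem_graph_of_sq_eq hA hP h hxy
  rwa [graph_fun hxp hp']

/-- Polar decomposition: a bounded `U` with `A = U P`, vanishing on `ker A`, if `P² = A²`. -/
theorem exists_polar {A P : H →ₗ.[ℂ] H} (hA : IsSelfAdjoint A) (hP : IsSelfAdjoint P)
    (h : prod P P = prod A A) :
    ∃ U : H →L[ℂ] H, (∀ x y p, (x, y) ∈ A.graph → (x, p) ∈ P.graph → U p = y) ∧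
      ∀ x, (x, 0) ∈ A.graph → U x = 0 := by
  have hd := domain_eq_of_sq_eq hA hP h
  let N : Submodule ℂ H := (LinearMap.range P.toFun).topologicalClosure
  have : CompleteSpace N := (Submodule.isClosed_topologicalClosure _).completeSpace_coe
  let e : P.domain →ₗ[ℂ] N :=
    P.toFun.codRestrict N fun x => Submodule.le_topologicalClosure _ ⟨x, rfl⟩
  let f : P.domain →ₗ[ℂ] H := A.toFun.comp (Submodule.inclusion hd.le)
  have hgr : ∀ x : P.domain, ((x : H), f x) ∈ A.graph :=
    fun x => LinearPMap.mem_graph A (Submodule.inclusion hd.le x)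
  have hgr' : ∀ x : P.domain, ((x : H), (e x : H)) ∈ P.graph := fun x => LinearPMap.mem_graph P x
  have hnorm : ∀ x, ‖f x‖ ≤ 1 * ‖e x‖ := by
    intro x
    rw [one_mul]
    exact (norm_eq_of_sq_eq hA hP h (hgr x) (hgr' x)).ge
  have hdense : DenseRange e := by
    intro y
    rw [closure_subtype]
    have h1 : (y : H) ∈ closure (LinearMap.range P.toFun : Set H) := y.2
    refine closure_mono ?_ h1
    rintro _ ⟨x, rfl⟩
    exact ⟨e x, ⟨x, rfl⟩, rfl⟩
  -- `P x ↦ A x` is isometric, extends to the closure `N` of `ran P`, and is continued by `0` to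
  -- `Nᗮ`, which contains `ker P = ker A`.
  let U : H →L[ℂ] H := (LinearMap.extendOfNorm f e).comp N.orthogonalProjectionOnto
  refine ⟨U, fun x y p hy hp => ?_, fun x hx => ?_⟩
  · obtain ⟨u, hu, hup⟩ := (LinearPMap.mem_graph_iff _).1 hp
    simp only at hu hup
    subst hu
    have h1 : (e u : H) = p := hup
    have h2 : N.orthogonalProjectionOnto p = e u := by
      rw [← h1]
      exact Submodule.orthogonalProjectionOnto_mem_subspace_eq_self _
    change LinearMap.extendOfNorm f e (N.orthogonalProjectionOnto p) = y
    rw [h2, LinearMap.extendOfNorm_eq hdense ⟨1, hnorm⟩]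
    exact graph_fun (hgr u) hy
  · have h0 : (x, (0 : H)) ∈ P.graph := by
      obtain ⟨p, hp, hpn⟩ := exists_mem_graph_of_sq_eq hA hP h hx
      rw [norm_zero, norm_eq_zero] at hpn
      rwa [hpn] at hp
    have h1 : x ∈ Nᗮ := by
      rw [Submodule.orthogonal_closure, Submodule.mem_orthogonal']
      rintro _ ⟨u, rfl⟩
      have := inner_graph_symm hP h0 (LinearPMap.mem_graph P u)
      rw [inner_zero_left] at this
      exact this.symm
    change LinearMap.extendOfNorm f e (N.orthogonalProjectionOnto x) = 0
    rw [Submodule.orthogonalProjectionOnto_apply_of_mem_orthogonal h1, map_zero]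

/-- The polar factor commutes with `A`. -/
theorem polar_commute {A P : H →ₗ.[ℂ] H} (hA : IsSelfAdjoint A) (hP : IsSelfAdjoint P)
    (hP0 : IsBoundedBelowBy P 0) (h : prod P P = prod A A) {U : H →L[ℂ] H}
    (hU : ∀ x y p, (x, y) ∈ A.graph → (x, p) ∈ P.graph → U p = y)
    (hU0 : ∀ x, (x, 0) ∈ A.graph → U x = 0) {x y : H} (hxy : (x, y) ∈ A.graph) :
    (U x, U y) ∈ A.graph := by
  obtain ⟨R, hR, hR'⟩ := exists_resolvent_I hA
  have hRA : ∀ {x y}, (x, y) ∈ A.graph → (R x, R y) ∈ A.graph := by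
    intro x y hxy
    have h1 := hR (y - Complex.I • x)
    rw [hR' x y hxy] at h1
    have h2 : R y = x + Complex.I • R x := by
      have := hR' x y hxy
      rw [map_sub, map_smul, sub_eq_iff_eq_add] at this
      exact this
    rw [h2]
    exact hR x
  have hRP : ∀ {x p}, (x, p) ∈ P.graph → (R x, R p) ∈ P.graph := by
    intro x p hxp
    refine graph_commute_of_sq hP hP0 (fun x z hxz => ?_) hxp
    rw [h] at hxz ⊢
    obtain ⟨y, h1, h2⟩ := mem_graph_prod.1 hxz
    exact mem_graph_prod.2 ⟨_, hRA h1, hRA h2⟩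
  -- The resolvent `R` commutes with `A`, so with `A² = P²`, so with `P`; hence `U R = R U` on `ran
  -- P` and on `ker P`.
  have hcomm : U.comp R = R.comp U := by
    refine ext_range_ker hP (fun x p hxp => ?_) fun k hk => ?_
    · obtain ⟨y, hy, -⟩ := exists_mem_graph_of_sq_eq hP hA h.symm hxp
      change U (R p) = R (U p)
      rw [hU x y p hy hxp, hU _ _ _ (hRA hy) (hRP hxp)]
    · obtain ⟨y, hy, hyn⟩ := exists_mem_graph_of_sq_eq hP hA h.symm hk
      rw [norm_zero, norm_eq_zero] at hyn
      rw [hyn] at hy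
      have h1 := hRA hy
      rw [map_zero] at h1
      change U (R k) = R (U k)
      rw [hU0 _ hy, hU0 _ h1, map_zero]
  have hc : ∀ w, U (R w) = R (U w) := fun w => congrArg (fun f : H →L[ℂ] H => f w) hcomm
  have h1 := hR (U (y - Complex.I • x))
  rw [← hc, hR' x y hxy] at h1
  convert h1 using 2
  rw [map_sub, map_smul]
  abel

/-- `U` commutes with `A`, so with `A² = P²`, so with the nonnegative root `P`. -/
theorem polar_commute_abs {A P : H →ₗ.[ℂ] H} (hA : IsSelfAdjoint A) (hP : IsSelfAdjoint P)
    (hP0 : IsBoundedBelowBy P 0) (h : prod P P = prod A A) {U : H →L[ℂ] H}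
    (hU : ∀ x y p, (x, y) ∈ A.graph → (x, p) ∈ P.graph → U p = y)
    (hU0 : ∀ x, (x, 0) ∈ A.graph → U x = 0) {x y : H} (hxy : (x, y) ∈ P.graph) :
    (U x, U y) ∈ P.graph := by
  refine graph_commute_of_sq hP hP0 (fun x z hxz => ?_) hxy
  rw [h] at hxz ⊢
  obtain ⟨y, h1, h2⟩ := mem_graph_prod.1 hxz
  exact mem_graph_prod.2 ⟨_, polar_commute hA hP hP0 h hU hU0 h1,
    polar_commute hA hP hP0 h hU hU0 h2⟩

/-- The polar factor of a self-adjoint operator is self-adjoint. -/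
theorem polar_symm {A P : H →ₗ.[ℂ] H} (hA : IsSelfAdjoint A) (hP : IsSelfAdjoint P)
    (hP0 : IsBoundedBelowBy P 0) (h : prod P P = prod A A) {U : H →L[ℂ] H}
    (hU : ∀ x y p, (x, y) ∈ A.graph → (x, p) ∈ P.graph → U p = y)
    (hU0 : ∀ x, (x, 0) ∈ A.graph → U x = 0) (u w : H) : ⟪U u, w⟫_ℂ = ⟪u, U w⟫_ℂ := by
  have hA_of_P : ∀ {x p}, (x, p) ∈ P.graph → (x, U p) ∈ A.graph := by
    intro x p hxp
    obtain ⟨y, hy, -⟩ := exists_mem_graph_of_sq_eq hP hA h.symm hxp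
    rwa [hU x y p hy hxp]
  have hker : ∀ {k}, (k, (0 : H)) ∈ P.graph → (k, (0 : H)) ∈ A.graph := by
    intro k hk
    simpa using hA_of_P hk
  have hswap : ∀ {x p y q}, (x, p) ∈ P.graph → (y, q) ∈ P.graph → ⟪p, U q⟫_ℂ = ⟪U p, q⟫_ℂ := by
    intro x p y q hx hy
    have hclosed : IsClosed {r : H × H | ⟪r.2, U q⟫_ℂ = ⟪U r.2, q⟫_ℂ} :=
      isClosed_eq (by fun_prop) (by fun_prop)
    refine closure_minimal ?_ hclosed (mem_closure_core hP hx)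
    rintro ⟨x, p⟩ ⟨h1, z, h2⟩
    have h3 : (U p, U z) ∈ P.graph := polar_commute_abs hA hP hP0 h hU hU0 h2
    change ⟪p, U q⟫_ℂ = ⟪U p, q⟫_ℂ
    -- With `z = P p` and `q = P y`: `(p, U q) = (p, A y) = (A p, y) = (U z, y) = (P U p, y) = (U p,
    -- q)`.
    rw [← inner_graph_symm hA (hA_of_P h2) (hA_of_P hy), ← inner_graph_symm hP h3 hy]
  have hadj : U.adjoint = U := by
    refine ext_range_ker hP (fun x p hxp => ?_) fun k hk => ?_
    · rw [← sub_eq_zero]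
      refine eq_zero_of_inner_range_ker hP (fun y q hyq => ?_) fun k hk => ?_
      · rw [inner_sub_left, ContinuousLinearMap.adjoint_inner_left, hswap hxp hyq, sub_self]
      · rw [inner_sub_left, ContinuousLinearMap.adjoint_inner_left, hU0 k (hker hk),
          inner_graph_symm hA (hA_of_P hxp) (hker hk)]
        simp
    · rw [hU0 k (hker hk)]
      refine eq_zero_of_inner_range_ker hP (fun y q hyq => ?_) fun l hl => ?_
      · rw [ContinuousLinearMap.adjoint_inner_left, ← inner_graph_symm hA (hker hk) (hA_of_P hyq)]
        simp
      · rw [ContinuousLinearMap.adjoint_inner_left, hU0 l (hker hl), inner_zero_right]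
  rw [← ContinuousLinearMap.adjoint_inner_left, hadj]

/-- Existence is all that `Classical.epsilon` requires; what follows holds for whichever root is
chosen. -/
theorem isNonnegSqrt_sqrt {T : H →ₗ.[ℂ] H} (hT : IsSelfAdjoint T) (h0 : IsBoundedBelowBy T 0) :
    IsNonnegSqrt (sqrt T) T :=
  Classical.epsilon_spec (exists_isNonnegSqrt hT h0)

theorem isNonnegSqrt_abs {A : H →ₗ.[ℂ] H} (hA : IsSelfAdjoint A) :
    IsNonnegSqrt (abs A) (prod A A) := by
  have h := isNonnegSqrt_sqrt (isSelfAdjoint_sq hA) (isBoundedBelowBy_sq hA)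
  have h2 : abs A = sqrt (prod A A) := by
    rw [abs, LinearPMap.isSelfAdjoint_def.1 hA]
  rwa [h2]

theorem isNonnegSqrt_absSqrt {A : H →ₗ.[ℂ] H} (hA : IsSelfAdjoint A) :
    IsNonnegSqrt (absSqrt A) (abs A) :=
  isNonnegSqrt_sqrt (isNonnegSqrt_abs hA).1 (isNonnegSqrt_abs hA).2.1

theorem isPolarFactor_sgn {A : H →ₗ.[ℂ] H} (hA : IsSelfAdjoint A) : IsPolarFactor (sgn A) A := by
  refine Classical.epsilon_spec (p := fun U => IsPolarFactor U A) ?_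
  obtain ⟨hP, hP0, h⟩ := isNonnegSqrt_abs hA
  obtain ⟨U, hU, hU0⟩ := exists_polar hA hP h
  refine ⟨U, domain_eq_of_sq_eq hA hP h, fun x hx hx' => ?_, fun x hx => ?_⟩
  · exact hU x _ _ (LinearPMap.mem_graph A ⟨x, hx'⟩) (LinearPMap.mem_graph (abs A) ⟨x, hx⟩)
  · refine hU0 x ?_
    rw [← hx]
    exact LinearPMap.mem_graph A x

theorem sgn_apply_of_mem_graph {A : H →ₗ.[ℂ] H} (hA : IsSelfAdjoint A) {x y p : H}
    (hy : (x, y) ∈ A.graph) (hp : (x, p) ∈ (abs A).graph) : sgn A p = y := by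
  have h1 := LinearPMap.mem_domain_of_mem_graph hy
  have h2 := LinearPMap.mem_domain_of_mem_graph hp
  have := (isPolarFactor_sgn hA).2.1 x h2 h1
  rwa [apply_eq_of_mem_graph hy, apply_eq_of_mem_graph hp] at this

theorem sgn_eq_zero_of_mem_graph {A : H →ₗ.[ℂ] H} (hA : IsSelfAdjoint A) {x : H}
    (hx : (x, 0) ∈ A.graph) : sgn A x = 0 :=
  (isPolarFactor_sgn hA).2.2 ⟨x, LinearPMap.mem_domain_of_mem_graph hx⟩
    (apply_eq_of_mem_graph hx _)

theorem sgn_symm {A : H →ₗ.[ℂ] H} (hA : IsSelfAdjoint A) (u w : H) :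
    ⟪sgn A u, w⟫_ℂ = ⟪u, sgn A w⟫_ℂ := by
  obtain ⟨hP, hP0, h⟩ := isNonnegSqrt_abs hA
  exact polar_symm hA hP hP0 h (fun _ _ _ => sgn_apply_of_mem_graph hA)
    (fun _ => sgn_eq_zero_of_mem_graph hA) u w

theorem sgn_commute_absSqrt {A : H →ₗ.[ℂ] H} (hA : IsSelfAdjoint A) {x y : H}
    (hxy : (x, y) ∈ (absSqrt A).graph) : (sgn A x, sgn A y) ∈ (absSqrt A).graph := by
  obtain ⟨hP, hP0, h⟩ := isNonnegSqrt_abs hA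
  obtain ⟨hQ, hQ0, hQP⟩ := isNonnegSqrt_absSqrt hA
  refine graph_commute_of_sq hQ hQ0 (fun x z hxz => ?_) hxy
  rw [hQP] at hxz ⊢
  exact polar_commute_abs hA hP hP0 h (fun _ _ _ => sgn_apply_of_mem_graph hA)
    (fun _ => sgn_eq_zero_of_mem_graph hA) hxz

theorem domain_le_absSqrt_domain {A : H →ₗ.[ℂ] H} (hA : IsSelfAdjoint A) :
    A.domain ≤ (absSqrt A).domain := by
  intro x hx
  rw [← (isPolarFactor_sgn hA).1, ← (isNonnegSqrt_absSqrt hA).2.2] at hx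
  obtain ⟨z, hz⟩ := LinearPMap.mem_domain_iff.1 hx
  obtain ⟨y, h1, -⟩ := mem_graph_prod.1 hz
  exact LinearPMap.mem_domain_of_mem_graph h1

/-- The sesquilinear form `(|A|^{1/2} f, sgn(A) |A|^{1/2} g)` of `A`. -/
def formOf (A : H →ₗ.[ℂ] H) :
    (absSqrt A).domain →ₗ⋆[ℂ] (absSqrt A).domain →ₗ[ℂ] ℂ :=
  ((innerₛₗ ℂ).comp (absSqrt A).toFun).compl₂
    ((sgn A : H →ₗ[ℂ] H).comp (absSqrt A).toFun)

theorem formOf_apply (A : H →ₗ.[ℂ] H) (f g : (absSqrt A).domain) :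
    formOf A f g = ⟪absSqrt A f, sgn A (absSqrt A g)⟫_ℂ :=
  rfl

theorem formOf_conj {A : H →ₗ.[ℂ] H} (hA : IsSelfAdjoint A) (f g : (absSqrt A).domain) :
    starRingEnd ℂ (formOf A f g) = formOf A g f := by
  rw [formOf_apply, formOf_apply, inner_conj_symm, sgn_symm hA]

/-- With `Q = |A|^{1/2}`: `(Q f, sgn A (Q g)) = (f, Q (sgn A (Q g))) = (f, sgn A (Q (Q g))) = (f, A
g)`. -/
theorem formOf_apply_of_mem_domain {A : H →ₗ.[ℂ] H} (hA : IsSelfAdjoint A)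
    (f g : (absSqrt A).domain) (hg : (g : H) ∈ A.domain) :
    formOf A f g = ⟪(f : H), A ⟨g, hg⟩⟫_ℂ := by
  have h1 : (g : H) ∈ (prod (absSqrt A) (absSqrt A)).domain := by
    rwa [(isNonnegSqrt_absSqrt hA).2.2, (isPolarFactor_sgn hA).1]
  obtain ⟨p, hp⟩ := LinearPMap.mem_domain_iff.1 h1
  obtain ⟨q, hgq, hqp⟩ := mem_graph_prod.1 hp
  rw [(isNonnegSqrt_absSqrt hA).2.2] at hp
  have h2 : sgn A p = A ⟨g, hg⟩ :=
    sgn_apply_of_mem_graph hA (LinearPMap.mem_graph A ⟨g, hg⟩) hp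
  have h3 : absSqrt A g = q := apply_eq_of_mem_graph hgq g.2
  rw [formOf_apply, h3, ← h2]
  exact inner_graph_symm (isNonnegSqrt_absSqrt hA).1 (LinearPMap.mem_graph _ f)
    (sgn_commute_absSqrt hA hqp)

end Polar


/-! ### Successive minimizers are eigenvectors -/

section MinMax

/-- A nonnegative Hermitian form vanishes against its null vectors. -/
theorem apply_eq_zero_of_nonneg {E : Type*} [AddCommGroup E] [Module ℂ E]
    (b : E →ₗ⋆[ℂ] E →ₗ[ℂ] ℂ) (hb : ∀ f g, starRingEnd ℂ (b f g) = b g f) (M : Submodule ℂ E)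
    (h0 : ∀ f ∈ M, 0 ≤ (b f f).re) {u f : E} (hu : u ∈ M) (huu : (b u u).re = 0) (hf : f ∈ M) :
    b f u = 0 := by
  set β := b f u with hβ
  have hβ' : b u f = starRingEnd ℂ β := (hb f u).symm
  set m := (b f f).re with hm
  have hm0 : 0 ≤ m := h0 f hf
  have hff : b f f = (m : ℂ) := by
    rw [hm, ← Complex.conj_eq_iff_re.1 (hb f f)]
    simp
  -- The form at `u - tβ f` equals `t |β|² (t m - 2)`. This `t` makes `t m < 1`, also when `m = 0`,
  -- so `β ≠ 0` would make it negative.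
  set t : ℝ := 1 / (m + 1) with ht
  have ht0 : 0 < t := by positivity
  have htm : t * (m + 1) = 1 := by rw [ht]; field_simp
  have h1 := h0 (u - ((t : ℂ) * β) • f) (M.sub_mem hu (M.smul_mem _ hf))
  have h2 : (b (u - ((t : ℂ) * β) • f) (u - ((t : ℂ) * β) • f)).re =
      -2 * t * Complex.normSq β + t ^ 2 * Complex.normSq β * m := by
    simp only [map_sub, LinearMap.sub_apply, map_smul, LinearMap.map_smulₛₗ, LinearMap.smul_apply,
      smul_eq_mul, map_mul, Complex.conj_ofReal, hβ', ← hβ, hff]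
    have e1 : ((t : ℂ) * β * (starRingEnd ℂ) β) = ((t * Complex.normSq β : ℝ) : ℂ) := by
      rw [mul_assoc, Complex.mul_conj]; push_cast; ring
    have e2 : ((t : ℂ) * (starRingEnd ℂ) β * β) = ((t * Complex.normSq β : ℝ) : ℂ) := by
      rw [mul_assoc, mul_comm _ β, Complex.mul_conj]; push_cast; ring
    have e3 : ((t : ℂ) * β * ((t : ℂ) * (starRingEnd ℂ) β * m)) =
        ((t ^ 2 * Complex.normSq β * m : ℝ) : ℂ) := by
      push_cast; rw [← Complex.mul_conj]; ring
    simp only [mul_sub, e1, e2, e3, Complex.sub_re, huu, Complex.ofReal_re]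
    ring
  rw [h2] at h1
  have h3 := Complex.normSq_nonneg β
  have h4 : Complex.normSq β = 0 := by
    by_contra hne
    have h5 : 0 < Complex.normSq β := lt_of_le_of_ne h3 (Ne.symm hne)
    have h6 : 0 < t * Complex.normSq β := mul_pos ht0 h5
    have h7 : -2 * t * Complex.normSq β + t ^ 2 * Complex.normSq β * m =
        (t * Complex.normSq β) * (t * m - 2) := by ring
    rw [h7] at h1
    have h8 : t * m < 1 := by linarith
    nlinarith
  exact Complex.normSq_eq_zero.1 h4

theorem mem_eigenspace_iff {A : H →ₗ.[ℂ] H} {z : ℂ} {x : H} :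
    x ∈ eigenspace A z ↔ (x, z • x) ∈ A.graph := by
  constructor
  · rintro ⟨u, hu, rfl⟩
    have h1 : A u - z • (u : H) = 0 := hu
    have h2 := LinearPMap.mem_graph A u
    rwa [sub_eq_zero.1 h1] at h2
  · intro h
    obtain ⟨u, hu, hu2⟩ := (LinearPMap.mem_graph_iff _).1 h
    simp only at hu hu2
    refine ⟨u, ?_, hu⟩
    change A u - z • (u : H) = 0
    rw [hu2, hu, sub_self]

/-- A subspace of dimension at least `j` contains a nonzero vector orthogonal to `j - 1` given
vectors. -/
theorem exists_orthogonal_of_le_rank (W : Submodule ℂ H) (w : ℕ → H) {j : ℕ} (hj : 1 ≤ j)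
    (hW : (j : Cardinal) ≤ Module.rank ℂ W) :
    ∃ f ∈ W, f ≠ 0 ∧ ∀ k, 1 ≤ k → k < j → ⟪f, w k⟫_ℂ = 0 := by
  -- The `j - 1` conditions cannot be injective on `W`; the shift `i + 1` matches indices starting
  -- at `1`.
  let L : W →ₗ[ℂ] (Fin (j - 1) → ℂ) :=
    LinearMap.pi fun i => (innerₛₗ ℂ (w (i + 1))).comp W.subtype
  have hL : ¬ Function.Injective L := by
    intro h
    have h1 := LinearMap.lift_rank_le_of_injective L h
    simp only [rank_fin_fun, Cardinal.lift_natCast] at h1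
    have h2 : Cardinal.lift.{0} (j : Cardinal) ≤ Cardinal.lift.{0} (Module.rank ℂ W) :=
      Cardinal.lift_le.2 hW
    rw [Cardinal.lift_natCast] at h2
    have h3 := h2.trans h1
    have h4 : j ≤ j - 1 := by exact_mod_cast h3
    omega
  rw [← LinearMap.ker_eq_bot, Submodule.eq_bot_iff] at hL
  push Not at hL
  obtain ⟨f, hf, hf0⟩ := hL
  refine ⟨f, f.2, by simpa using hf0, fun k hk hkj => ?_⟩
  have h1 : L f ⟨k - 1, by omega⟩ = 0 := by rw [LinearMap.mem_ker.1 hf]; rfl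
  have h2 : ⟪w (k - 1 + 1), (f : H)⟫_ℂ = 0 := h1
  rw [Nat.sub_add_cancel hk] at h2
  exact inner_eq_zero_symm.1 h2

/-- A subspace that contains `j` nonzero orthogonal vectors has dimension at least `j`. -/
theorem le_rank_of_orthogonal (W : Submodule ℂ H) (w : ℕ → H) {j : ℕ}
    (hw : ∀ k, 1 ≤ k → k ≤ j → w k ∈ W ∧ w k ≠ 0)
    (ho : ∀ k l, 1 ≤ k → k < l → l ≤ j → ⟪w l, w k⟫_ℂ = 0) :
    (j : Cardinal) ≤ Module.rank ℂ W := by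
  let g : Fin j → W := fun i => ⟨w (i + 1), (hw _ (by omega) (by omega)).1⟩
  have hli : LinearIndependent ℂ g := by
    refine linearIndependent_of_ne_zero_of_inner_eq_zero (fun i hi => ?_) fun i l hil => ?_
    · exact (hw (i + 1) (by omega) (by omega)).2 (congrArg Subtype.val hi)
    · change ⟪w (i + 1), w (l + 1)⟫_ℂ = 0
      rcases lt_or_gt_of_ne (fun h => hil (Fin.ext h) : (i : ℕ) ≠ l) with h | h
      · exact inner_eq_zero_symm.1 (ho _ _ (by omega) (by omega) (by omega))
      · exact ho _ _ (by omega) (by omega) (by omega)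
  simpa using hli.cardinal_lift_le_rank

/-- The subspace of vectors orthogonal to `v 1, …, v (j - 1)`. -/
def orthogonalBelow {D : Submodule ℂ H} (v : ℕ → D) (j : ℕ) : Submodule ℂ D where
  carrier := {f | ∀ k : ℕ, 1 ≤ k → k < j → ⟪(f : H), (v k : H)⟫_ℂ = 0}
  zero_mem' := fun k _ _ => by simp
  add_mem' := fun {f g} hf hg k h1 h2 => by
    simp [hf k h1 h2, hg k h1 h2]
  smul_mem' := fun z f hf k h1 h2 => by
    simp [hf k h1 h2]

theorem indexSet_mono {A : H →ₗ.[ℂ] H} {j k : ℕ} (hj : j ∈ indexSet A) (hk : 1 ≤ k)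
    (hkj : k ≤ j) : k ∈ indexSet A :=
  ⟨hk, le_trans (by exact_mod_cast hkj) hj.2⟩

/-- The form `(f, A g)` on `dom A`. -/
def operatorForm (A : H →ₗ.[ℂ] H) : A.domain →ₗ⋆[ℂ] A.domain →ₗ[ℂ] ℂ :=
  ((innerₛₗ ℂ).comp A.domain.subtype).compl₂ A.toFun

theorem operatorForm_apply (A : H →ₗ.[ℂ] H) (f g : A.domain) :
    operatorForm A f g = ⟪(f : H), A g⟫_ℂ :=
  rfl

variable [CompleteSpace H]

theorem inner_eigenspace_eq_zero {A : H →ₗ.[ℂ] H} (hA : IsSelfAdjoint A) {s t : ℝ} (hst : s ≠ t)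
    {x y : H} (hx : x ∈ eigenspace A (s : ℂ)) (hy : y ∈ eigenspace A (t : ℂ)) : ⟪x, y⟫_ℂ = 0 := by
  have h := inner_graph_symm hA (mem_eigenspace_iff.1 hx) (mem_eigenspace_iff.1 hy)
  rw [inner_smul_left, inner_smul_right, Complex.conj_ofReal] at h
  have h2 : ((s : ℂ) - t) * ⟪x, y⟫_ℂ = 0 := by linear_combination h
  refine (mul_eq_zero.1 h2).resolve_left ?_
  exact sub_ne_zero.2 (by exact_mod_cast hst)

/-- On a sum of eigenspaces, the Rayleigh quotient is at most one of the eigenvalues. -/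
theorem exists_rayleigh_le_of_mem_iSup {A : H →ₗ.[ℂ] H} (hA : IsSelfAdjoint A) (p : ℝ → Prop)
    {f : H} (hf : f ∈ ⨆ (t : ℝ) (_ : p t), eigenspace A (t : ℂ)) (hf0 : f ≠ 0) :
    ∃ g, (f, g) ∈ A.graph ∧ ∃ t, p t ∧ (⟪f, g⟫_ℂ).re ≤ t * ‖f‖ ^ 2 := by
  rw [iSup_subtype', Submodule.mem_iSup_iff_exists_finsupp] at hf
  obtain ⟨c, hc, rfl⟩ := hf
  have hne : c.support.Nonempty := by
    rw [Finset.nonempty_iff_ne_empty]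
    intro h
    exact hf0 (by rw [Finsupp.sum, h, Finset.sum_empty])
  have horth : ∀ i k, i ≠ k → ⟪c i, c k⟫_ℂ = 0 := fun i k hik =>
    inner_eigenspace_eq_zero hA (fun h => hik (Subtype.ext h)) (hc i) (hc k)
  have hinner : ∀ r : {t : ℝ // p t} → ℝ,
      ⟪∑ i ∈ c.support, c i, ∑ k ∈ c.support, (r k : ℂ) • c k⟫_ℂ =
        ((∑ i ∈ c.support, r i * ‖c i‖ ^ 2 : ℝ) : ℂ) := by
    intro r
    rw [sum_inner]
    push_cast
    refine Finset.sum_congr rfl fun i hi => ?_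
    rw [inner_sum, Finset.sum_eq_single_of_mem i hi]
    · rw [inner_smul_right, inner_self_eq_norm_sq_to_K]; rfl
    · intro k _ hki
      rw [inner_smul_right, horth i k hki.symm, mul_zero]
  -- `m` is the largest eigenvalue that occurs in `f`.
  obtain ⟨m, hm, hmax⟩ := Finset.exists_max_image c.support (fun i => (i : ℝ)) hne
  refine ⟨∑ i ∈ c.support, ((i : ℝ) : ℂ) • c i, ?_, m, m.2, ?_⟩
  · have := A.graph.sum_mem fun i (_ : i ∈ c.support) => mem_eigenspace_iff.1 (hc i)
    convert this using 1
    ext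
    · rw [Prod.fst_sum]; rfl
    · rw [Prod.snd_sum]
  · have h1 := hinner fun _ => 1
    simp only [Complex.ofReal_one, one_smul, one_mul] at h1
    rw [inner_self_eq_norm_sq_to_K] at h1
    change ((‖∑ i ∈ c.support, c i‖ : ℝ) : ℂ) ^ 2 = _ at h1
    have h2 : ‖∑ i ∈ c.support, c i‖ ^ 2 = ∑ i ∈ c.support, ‖c i‖ ^ 2 := by exact_mod_cast h1
    rw [Finsupp.sum, hinner fun i => (i : ℝ), Complex.ofReal_re, h2, Finset.mul_sum]
    exact Finset.sum_le_sum fun i hi => mul_le_mul_of_nonneg_right (hmax i hi) (sq_nonneg _)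

/-- Successive minimizers of the Rayleigh quotient of a Hermitian form that extends the form of
`A` are eigenvectors of `A`. -/
theorem mem_graph_of_successivelyMinimizes {A : H →ₗ.[ℂ] H} (hA : IsSelfAdjoint A)
    {D : Submodule ℂ H} (hD : A.domain ≤ D) (a : D →ₗ⋆[ℂ] D →ₗ[ℂ] ℂ)
    (hconj : ∀ f g, starRingEnd ℂ (a f g) = a g f)
    (ha : ∀ (f g : D) (hg : (g : H) ∈ A.domain), a f g = ⟪(f : H), A ⟨g, hg⟩⟫_ℂ)
    {R : D → ℝ} (hR : ∀ f, R f = (a f f).re / ‖(f : H)‖ ^ 2) {v : ℕ → D} {μ : ℕ → ℝ}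
    (hv : SuccessivelyMinimizes R (indexSet A) v μ) {j : ℕ} (hj : j ∈ indexSet A) :
    ((v j : H), (μ j : ℂ) • (v j : H)) ∈ A.graph := by
  induction j using Nat.strong_induction_on with
  | _ j ih =>
  have ih' : ∀ k, 1 ≤ k → k < j → ((v k : H), (μ k : ℂ) • (v k : H)) ∈ A.graph :=
    fun k hk hkj => ih k hkj (indexSet_mono hj hk hkj.le)
  obtain ⟨⟨hne, horth⟩, hμ, hleast⟩ := hv j hj
  let b : D →ₗ⋆[ℂ] D →ₗ[ℂ] ℂ :=
    a - (μ j : ℂ) • ((innerₛₗ ℂ).comp D.subtype).compl₂ D.subtype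
  have hb : ∀ f g, b f g = a f g - μ j * ⟪(f : H), (g : H)⟫_ℂ := fun f g => rfl
  have hbconj : ∀ f g, starRingEnd ℂ (b f g) = b g f := by
    intro f g
    rw [hb, hb, map_sub, map_mul, hconj, inner_conj_symm, Complex.conj_ofReal]
  have hbre : ∀ f, (b f f).re = (a f f).re - μ j * ‖(f : H)‖ ^ 2 := by
    intro f
    rw [hb, Complex.sub_re, Complex.re_ofReal_mul, inner_self_eq_norm_sq_to_K]
    norm_cast
  have hpos : ∀ f : D, f ≠ 0 → 0 < ‖(f : H)‖ ^ 2 := fun f hf => by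
    have : (f : H) ≠ 0 := by simpa using hf
    positivity
  have hmin : ∀ f ∈ orthogonalBelow v j, 0 ≤ (b f f).re := by
    intro f hf
    by_cases hf0 : f = 0
    · simp [hf0]
    have h1 : μ j ≤ R f := hleast.2 ⟨f, ⟨hf0, hf⟩, rfl⟩
    rw [hR, le_div_iff₀ (hpos f hf0)] at h1
    rw [hbre]
    linarith
  have hzero : (b (v j) (v j)).re = 0 := by
    rw [hR, eq_div_iff (hpos _ hne).ne'] at hμ
    rw [hbre]
    linarith
  have hM : ∀ f ∈ orthogonalBelow v j, b f (v j) = 0 :=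
    fun f hf => apply_eq_zero_of_nonneg b hbconj _ hmin horth hzero hf
  have hvk : ∀ k, 1 ≤ k → k < j → b (v k) (v j) = 0 := by
    intro k hk hkj
    have hg := ih' k hk hkj
    have hd := LinearPMap.mem_domain_of_mem_graph hg
    rw [← hbconj, hb, ha _ _ hd, apply_eq_of_mem_graph hg, inner_smul_right, horth k hk hkj]
    simp
  have hall : ∀ g : D, b g (v j) = 0 := by
    intro g
    -- Gram–Schmidt coefficients; the corrected vector stays in `D` because each `v k` does.
    let c : ℕ → ℂ := fun k => ⟪(v k : H), (g : H)⟫_ℂ / (‖(v k : H)‖ : ℂ) ^ 2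
    have hs : g - ∑ k ∈ Finset.Ico 1 j, c k • v k ∈ orthogonalBelow v j := by
      intro l hl hlj
      have hvl := hv l (indexSet_mono hj hl hlj.le)
      have hnl : ((‖(v l : H)‖ : ℂ) ^ 2) ≠ 0 := by exact_mod_cast (hpos _ hvl.1.1).ne'
      have h1 : ⟪((∑ k ∈ Finset.Ico 1 j, c k • v k : D) : H), (v l : H)⟫_ℂ =
          ⟪(g : H), (v l : H)⟫_ℂ := by
        rw [Submodule.coe_sum, sum_inner,
          Finset.sum_eq_single_of_mem l (Finset.mem_Ico.2 ⟨hl, hlj⟩)]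
        · rw [Submodule.coe_smul, inner_smul_left, inner_self_eq_norm_sq_to_K]
          simp only [c, map_div₀, inner_conj_symm, map_pow, Complex.conj_ofReal,
            Complex.coe_algebraMap]
          exact div_mul_cancel₀ _ hnl
        · intro k hk hkl
          obtain ⟨hk1, hkj⟩ := Finset.mem_Ico.1 hk
          rw [Submodule.coe_smul, inner_smul_left]
          have : ⟪(v k : H), (v l : H)⟫_ℂ = 0 := by
            rcases lt_or_gt_of_ne hkl with h | h
            · exact inner_eq_zero_symm.1 (hvl.1.2 k hk1 h)
            · exact (hv k (indexSet_mono hj hk1 hkj.le)).1.2 l hl h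
          rw [this, mul_zero]
      rw [Submodule.coe_sub, inner_sub_left, h1, sub_self]
    have h2 := hM _ hs
    rw [map_sub, LinearMap.sub_apply, map_sum, LinearMap.sum_apply, Finset.sum_eq_zero,
      sub_zero] at h2
    · exact h2
    · intro k hk
      obtain ⟨hk1, hkj⟩ := Finset.mem_Ico.1 hk
      rw [LinearMap.map_smulₛₗ, LinearMap.smul_apply, hvk k hk1 hkj, smul_zero]
  refine mem_graph_of_forall_inner hA fun x y hxy => ?_
  have hx := LinearPMap.mem_domain_of_mem_graph hxy
  have h1 := hall ⟨x, hD hx⟩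
  rw [← hbconj, hb, ha _ _ hx, map_eq_zero, sub_eq_zero] at h1
  rw [apply_eq_of_mem_graph hxy] at h1
  rw [h1, inner_smul_left, Complex.conj_ofReal]

/-- The minimum values and the minimizers of the successive minimization problems are the ordered
eigenvalues of `A` and corresponding eigenvectors. -/
theorem eq_orderedEigenvalue_of_successivelyMinimizes {A : H →ₗ.[ℂ] H} (hA : IsSelfAdjoint A)
    {D : Submodule ℂ H} (hD : A.domain ≤ D) (a : D →ₗ⋆[ℂ] D →ₗ[ℂ] ℂ)
    (hconj : ∀ f g, starRingEnd ℂ (a f g) = a g f)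
    (ha : ∀ (f g : D) (hg : (g : H) ∈ A.domain), a f g = ⟪(f : H), A ⟨g, hg⟩⟫_ℂ)
    {R : D → ℝ} (hR : ∀ f, R f = (a f f).re / ‖(f : H)‖ ^ 2) {v : ℕ → D} {μ : ℕ → ℝ}
    (hv : SuccessivelyMinimizes R (indexSet A) v μ) {j : ℕ} (hj : j ∈ indexSet A) :
    μ j = orderedEigenvalue A j ∧ IsEigenvector A (orderedEigenvalue A j : ℂ) (v j : H) := by
  have hgraph : ∀ k, 1 ≤ k → k ≤ j → ((v k : H), (μ k : ℂ) • (v k : H)) ∈ A.graph :=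
    fun k hk hkj => mem_graph_of_successivelyMinimizes hA hD a hconj ha hR hv
      (indexSet_mono hj hk hkj)
  have hne : ∀ k, 1 ≤ k → k ≤ j → (v k : H) ≠ 0 := fun k hk hkj => by
    simpa using (hv k (indexSet_mono hj hk hkj)).1.1
  obtain ⟨hadm, hμ, hleast⟩ := hv j hj
  have hmono : ∀ k, 1 ≤ k → k ≤ j → μ k ≤ μ j := by
    intro k hk hkj
    rw [hμ]
    exact (hv k (indexSet_mono hj hk hkj)).2.2.2
      ⟨v j, ⟨hadm.1, fun l hl hlk => hadm.2 l hl (hlk.trans_le hkj)⟩, rfl⟩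
  -- The predicate `p` is left open: it is used with `t < infEss A`, for `μ j < infEss A`, and with
  -- `t ≤ e`, for minimality.
  have hupper : ∀ p : ℝ → Prop,
      (j : Cardinal) ≤ Module.rank ℂ (⨆ (t : ℝ) (_ : p t), eigenspace A (t : ℂ) :) →
      ∃ t, p t ∧ μ j ≤ t := by
    intro p hp
    obtain ⟨f, hfW, hf0, hfo⟩ :=
      exists_orthogonal_of_le_rank _ (fun k => (v k : H)) hj.1 hp
    obtain ⟨g, hg, t, ht, hle⟩ := exists_rayleigh_le_of_mem_iSup hA p hfW hf0
    have hfd := LinearPMap.mem_domain_of_mem_graph hg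
    refine ⟨t, ht, le_trans (hleast.2 ⟨⟨f, hD hfd⟩, ⟨?_, hfo⟩, rfl⟩) ?_⟩
    · intro h
      exact hf0 (congrArg Subtype.val h)
    · rw [hR, ha _ _ hfd, apply_eq_of_mem_graph hg]
      have : 0 < ‖f‖ ^ 2 := by positivity
      rwa [div_le_iff₀ this]
  have heig : ∀ k, 1 ≤ k → k ≤ j → (v k : H) ∈ eigenspace A (μ k : ℂ) :=
    fun k hk hkj => mem_eigenspace_iff.2 (hgraph k hk hkj)
  have hlt : (μ j : EReal) < infEss A := by
    obtain ⟨t, ht, hle⟩ := hupper _ hj.2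
    exact lt_of_le_of_lt (by exact_mod_cast hle) ht
  -- Attainment of the minimum makes the real `sInf` genuine, not its default value.
  have hS : IsLeast {e : ℝ | (e : EReal) < infEss A ∧ eigenspace A (e : ℂ) ≠ ⊥ ∧
      (j : Cardinal) ≤ Module.rank ℂ (⨆ (t : ℝ) (_ : t ≤ e), eigenspace A (t : ℂ) :)} (μ j) := by
    refine ⟨⟨hlt, ?_, ?_⟩, ?_⟩
    · rw [Submodule.ne_bot_iff]
      exact ⟨_, heig j hj.1 le_rfl, hne j hj.1 le_rfl⟩
    · refine le_rank_of_orthogonal _ (fun k => (v k : H)) (fun k hk hkj => ⟨?_, hne k hk hkj⟩) ?_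
      · exact Submodule.mem_iSup_of_mem (μ k)
          (Submodule.mem_iSup_of_mem (hmono k hk hkj) (heig k hk hkj))
      · intro k l hk hkl hlj
        exact (hv l (indexSet_mono hj (by omega) hlj)).1.2 k hk hkl
    · rintro e ⟨-, -, he⟩
      obtain ⟨t, ht, hle⟩ := hupper _ he
      exact hle.trans ht
  have heq : μ j = orderedEigenvalue A j := hS.csInf_eq.symm
  refine ⟨heq, hne j hj.1 le_rfl, ?_⟩
  rw [← heq]
  have h1 := hgraph j hj.1 le_rfl
  exact ⟨LinearPMap.mem_domain_of_mem_graph h1, apply_eq_of_mem_graph h1 _⟩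

theorem operatorForm_conj {A : H →ₗ.[ℂ] H} (hA : IsSelfAdjoint A) (f g : A.domain) :
    starRingEnd ℂ (operatorForm A f g) = operatorForm A g f := by
  rw [operatorForm_apply, operatorForm_apply, inner_conj_symm]
  exact inner_graph_symm hA (LinearPMap.mem_graph A g) (LinearPMap.mem_graph A f)

end MinMax

end UnboundedOp

end

theorem theorem3p2 {H : Type*} [NormedAddCommGroup H] [InnerProductSpace ℂ H] [CompleteSpace H]
    (A : H →ₗ.[ℂ] H) (hA : IsSelfAdjoint A)
    (c : ℝ) (hc : UnboundedOp.IsBoundedBelowBy A c)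
    (hess : (c : EReal) < UnboundedOp.infEss A)
    (hdisc : ∃ t : ℝ, (t : ℂ) ∈ UnboundedOp.discreteSpectrum A ∧ c ≤ t ∧
      (t : EReal) < UnboundedOp.infEss A) :
    (∀ (v : ℕ → A.domain) (μ : ℕ → ℝ),
      UnboundedOp.SuccessivelyMinimizes (UnboundedOp.rayleigh A) (UnboundedOp.indexSet A) v μ →
      ∀ j ∈ UnboundedOp.indexSet A,
        μ j = UnboundedOp.orderedEigenvalue A j ∧
        UnboundedOp.IsEigenvector A (UnboundedOp.orderedEigenvalue A j : ℂ) (v j : H)) ∧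
    (∀ (v : ℕ → (UnboundedOp.absSqrt A).domain) (μ : ℕ → ℝ),
      UnboundedOp.SuccessivelyMinimizes (UnboundedOp.formRayleigh A) (UnboundedOp.indexSet A) v μ →
      ∀ j ∈ UnboundedOp.indexSet A,
        μ j = UnboundedOp.orderedEigenvalue A j ∧
        (v j : H) ∈ A.domain ∧
        UnboundedOp.IsEigenvector A (UnboundedOp.orderedEigenvalue A j : ℂ) (v j : H)) := by
  refine ⟨fun v μ hv j hj => ?_, fun v μ hv j hj => ?_⟩
  -- Here `D = dom A`; in the form version `D = dom |A|^{1/2}`.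
  · exact UnboundedOp.eq_orderedEigenvalue_of_successivelyMinimizes hA le_rfl
      (UnboundedOp.operatorForm A) (UnboundedOp.operatorForm_conj hA) (fun _ _ _ => rfl)
      (fun _ => rfl) hv hj
  · have h := UnboundedOp.eq_orderedEigenvalue_of_successivelyMinimizes hA
      (UnboundedOp.domain_le_absSqrt_domain hA) (UnboundedOp.formOf A)
      (UnboundedOp.formOf_conj hA) (UnboundedOp.formOf_apply_of_mem_domain hA)
      (fun _ => rfl) hv hj
    exact ⟨h.1, h.2.2.choose, h.2⟩
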